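/- A project is a pair $a=(F,c)$ of a probability distribution $F$ on $\mathbb{R}_+$ with finite expectation and a cost $c\ge 0$. A contract is a measurable function $w:\mathbb{R}_+\to\mathbb{R}$ with $w\ge 0$. Given a contract $w$ and a finite set $\mathcal{A}$ of projects, the agent searches sequentially with recall: starting from the prize $0$, which is always available, and depending on the set of projects sampled so far and on the highest wage available so far, he either samples one of the remaining projects $a_i=(F_i,c_i)$, paying $c_i$ and learning a prize $y_i\sim F_i$ (draws are independent), or stops and presents an available prize $y$ that gives him the highest wage (if there are several, the largest of them). The agent's payoff is $w(y)$ minus the costs of the projects sampled; the principal's payoff is $y-w(y)$. Let $\Sigma(w,\mathcal{A})$ be the set of search strategies that maximize the agent's expected payoff, let $V_P(w\mid\mathcal{A})$ be the supremum over $\Sigma(w,\mathcal{A})$ of the principal's expected payoff, and let $V_S(w\mid\mathcal{A})$ be the supremum over $\Sigma(w,\mathcal{A})$ of the expected sum of the two payoffs (the total surplus). Fix a known project $a_0=(F_0,c_0)$ with nonnegative surplus, $s_0:=\mathbb{E}_{F_0}[y]-c_0\ge 0$. A contract is robustly optimal if it maximizes $V_P(w):=\inf_{\mathcal{A}\ni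 a_0}V_P(w\mid\mathcal{A})$ over all contracts, where $\mathcal{A}$ ranges over the finite sets of projects that contain $a_0$. A contract is efficient if, for every finite set of projects $\mathcal{A}\ni a_0$, it maximizes $V_S(\cdot\mid\mathcal{A})$ over all contracts. Let $\underline{y}_0:=\inf(\operatorname{supp}F_0)$. (1) If $c_0\ge \mathbb{E}_{F_0}[y]-\underline{y}_0$, then the equation $c_0=\int[y-r]^+\,dF_0(y)$ has a smallest real solution $r_0$, and the pure debt contract $w_0(y)=[y-r_0]^+$ is the only contract that is both robustly optimal and efficient; in particular it has both properties. (2) If $c_0<\mathbb{E}_{F_0}[y]-\underline{y}_0$, then no robustly optimal contract is efficient. -/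

import Mathlib

open MeasureTheory
open scoped NNReal ENNReal

noncomputable section

namespace RobustSearch

/-- A project (a Pandora's box): a distribution of the nonnegative prize, with finite
expectation, and a nonnegative cost of learning the prize. -/
structure Project where
  /-- the distribution of the prize -/
  dist : Measure ℝ≥0
  /-- the cost of sampling the project -/
  cost : ℝ≥0
  isProb : IsProbabilityMeasure dist
  finite_mean : ∫⁻ y, (y : ℝ≥0∞) ∂dist < ⊤

namespace Project

instance (a : Project) : IsProbabilityMeasure a.dist := a.isProb

/-- The expected prize. -/
def mean (a : Project) : ℝ := ∫ y, (y : ℝ) ∂a.dist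

/-- The surplus of a project: expected prize net of the cost. -/
def surplus (a : Project) : ℝ := a.mean - a.cost

/-- The lowest possible prize, `inf (supp F)`. -/
def lowest (a : Project) : ℝ := ((sInf a.dist.support : ℝ≥0) : ℝ)

/-- The set of real solutions `r` of `c = ∫ [y - r]⁺ dF(y)`. -/
def indexSolutions (a : Project) : Set ℝ :=
  {r : ℝ | (a.cost : ℝ) = ∫ y, max ((y : ℝ) - r) 0 ∂a.dist}

/-- The (Weitzman) index of a project: the smallest solution of `c = ∫ [y - r]⁺ dF(y)`
(meaningful whenever there is a smallest real solution). -/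
def index (a : Project) : ℝ := sInf a.indexSolutions

end Project

/-- A wage contract: a measurable function `w : ℝ₊ → ℝ` with `w ≥ 0` (limited liability). -/
@[ext]
structure Contract where
  /-- the wage as a function of the presented prize -/
  wage : ℝ≥0 → ℝ≥0
  measurable_wage : Measurable wage

/-- The `z`-debt contract `y ↦ [y - z]⁺`. -/
def debt (z : ℝ) : Contract where
  wage y := Real.toNNReal ((y : ℝ) - z)
  measurable_wage := (measurable_subtype_coe.sub_const z).real_toNNReal

section Search

variable {ι : Type*} [Fintype ι]

/-- A search strategy over projects labelled by `ι`. The state consists of the set of projects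
sampled so far and the highest wage available so far; `next S v = some i` means that project `i`,
which has not been sampled yet, is sampled next, and `next S v = none` means that the
search ends. -/
structure Strategy (ι : Type*) where
  /-- the project to be sampled next, if any -/
  next : Finset ι → ℝ≥0 → Option ι
  fresh : ∀ S v i, next S v = some i → i ∉ S
  measurable_next : ∀ S o, MeasurableSet {v | next S v = o}

/-- The highest wage available when the projects in `S` have been sampled and the prizes are `y`;
the prize `0` can always be presented. -/
def bestWage (w : Contract) (y : ι → ℝ≥0) (S : Finset ι) : ℝ≥0 :=
  max (w.wage 0) (S.sup fun i => w.wage (y i))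

open Classical in
/-- One step of the search. -/
def step (w : Contract) (σ : Strategy ι) (y : ι → ℝ≥0) (S : Finset ι) : Finset ι :=
  match σ.next S (bestWage w y S) with
  | none => S
  | some i => insert i S

/-- The set of projects sampled by the end of the search. A search that has stopped stays in the
same state, and no search makes more steps than there are projects. -/
def sampled (w : Contract) (σ : Strategy ι) (y : ι → ℝ≥0) : Finset ι :=
  (step w σ y)^[Fintype.card ι] ∅

open Classical in
/-- The prize presented at the end of the search. It maximizes the wage among the sampled prizes
and `0`; ties are broken in favour of the principal, so it is the largest such prize
(if no sampled prize attains the highest wage, then only the prize `0` does). -/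
def prize (w : Contract) (σ : Strategy ι) (y : ι → ℝ≥0) : ℝ≥0 :=
  ((sampled w σ y).filter fun i => w.wage (y i) = bestWage w y (sampled w σ y)).sup y

/-- The joint law of the prizes: the draws are independent. -/
def law (a : ι → Project) : Measure (ι → ℝ≥0) := Measure.pi fun i => (a i).dist

/-- `E_σ[y]`, the expectation of the presented prize (it is finite). -/
def expPrize (a : ι → Project) (w : Contract) (σ : Strategy ι) : ℝ≥0∞ :=
  ∫⁻ y, (prize w σ y : ℝ≥0∞) ∂law a

/-- `E_σ[w(y)]`, the expected wage (possibly infinite). -/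
def expWage (a : ι → Project) (w : Contract) (σ : Strategy ι) : ℝ≥0∞ :=
  ∫⁻ y, (w.wage (prize w σ y) : ℝ≥0∞) ∂law a

/-- The expected total cost of the projects sampled (it is finite). -/
def expCost (a : ι → Project) (w : Contract) (σ : Strategy ι) : ℝ≥0∞ :=
  ∫⁻ y, ((∑ i ∈ sampled w σ y, (a i).cost : ℝ≥0) : ℝ≥0∞) ∂law a

/-- The agent's expected payoff `E_σ[w(y) - ∑ cᵢ 1{aᵢ ∈ σ}]`. -/
def agentPayoff (a : ι → Project) (w : Contract) (σ : Strategy ι) : EReal :=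
  (expWage a w σ : EReal) - (expCost a w σ : EReal)

/-- The principal's expected payoff `E_σ[y - w(y)]`. -/
def principalPayoff (a : ι → Project) (w : Contract) (σ : Strategy ι) : EReal :=
  (expPrize a w σ : EReal) - (expWage a w σ : EReal)

/-- The expected sum of the two players' payoffs, `E_σ[y - ∑ cᵢ 1{aᵢ ∈ σ}]`
(the wage is a transfer and cancels). -/
def jointPayoff (a : ι → Project) (w : Contract) (σ : Strategy ι) : EReal :=
  (expPrize a w σ : EReal) - (expCost a w σ : EReal)

/-- The set `Σ(w, 𝒜)` of the search strategies that are optimal for the agent. -/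
def optimalStrategies (a : ι → Project) (w : Contract) : Set (Strategy ι) :=
  {σ | ∀ τ : Strategy ι, agentPayoff a w τ ≤ agentPayoff a w σ}

end Search

/-- The projects of the set `A`, labelled by the elements of `A`. -/
def family (A : Finset Project) : A → Project := fun a => a

/-- `V_P(w | 𝒜)`: the principal's payoff when the agent breaks ties in her favour. -/
def principalValue (w : Contract) (A : Finset Project) : EReal :=
  ⨆ σ ∈ optimalStrategies (family A) w, principalPayoff (family A) w σ

/-- `V_S(w | 𝒜)`: the total surplus induced by the contract `w`. -/
def totalSurplus (w : Contract) (A : Finset Project) : EReal :=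
  ⨆ σ ∈ optimalStrategies (family A) w, jointPayoff (family A) w σ

/-- The payoff guarantee `V_P(w)`: the infimum of `V_P(w | 𝒜)` over all finite sets `𝒜` of
projects that contain the known project `a₀`. -/
def guarantee (a₀ : Project) (w : Contract) : EReal :=
  ⨅ (A : Finset Project) (_ : a₀ ∈ A), principalValue w A

/-- The contract `w` maximizes the payoff guarantee. -/
def IsRobustlyOptimal (a₀ : Project) (w : Contract) : Prop :=
  guarantee a₀ w = ⨆ w' : Contract, guarantee a₀ w'

/-- The contract `w` maximizes the total surplus for every set of projects that contains the
known one. -/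
def IsEfficient (a₀ : Project) (w : Contract) : Prop :=
  ∀ A : Finset Project, a₀ ∈ A → ∀ w' : Contract, totalSurplus w' A ≤ totalSurplus w A

end RobustSearch

end

/-! The engine is Weitzman's solution of the search problem in terms of capped values. The presented
value `h (y i)` splits into `min (h (y i)) (ρ i)` and the excess over `ρ i`. Sampling a project is
independent of its own prize, so if each expected excess is at most the cost, every strategy earns
at most `E[cappedMax]` net of costs (`lintegral_value_prize_le_cost`). With fair caps the index
policy attains this bound (`le_expWage_indexPolicy`). Taking `h` to be the wage solves the agent's
problem; taking `h` to be the identity gives the first best, which `debt 0` implements.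

Let `s` be the known surplus. Under `debt s` the known project is worth sampling, and some optimal
policy presents at least `min y₀ s`, where `y₀` is its prize. Hence the guarantee is at least `E[min
y₀ s]`. No contract guarantees more than `s`, because the known project may be the only one.

The condition in (1) says that `s ≤ y₀` almost surely. Then `r₀ = s`, and `debt s` guarantees
exactly `s`. It is efficient because it merely lowers every relevant prize by `s`. Conversely, a
guarantee of `s` forces `w 0 = 0` and `E[w] ≤ c₀`. A sure project then detects any deviation from
`[y - s]⁺`: an overpaid prize makes the agent sample a project that destroys surplus, an underpaid
one makes him refuse a project worth more than `s` (`robustlyOptimal_and_efficient_iff`).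

In (2) the lowest prize `l` is below `s`, and `debt s` guarantees strictly more than `l`. A robustly
optimal `w` must therefore leave the principal more than `l` at some prize `y`. A sure project with
prize `y` and surplus `q` slightly above `l` is then refused, although it has option value when `y₀
< q` (`le_of_isEfficient`). -/

namespace RobustSearch

/-! ### Paths of the search and the presented prize -/

section Paths

variable {ι : Type*} {w : Contract} {σ : Strategy ι} {y : ι → ℝ≥0}

open Classical in
theorem step_eq_of_some {S : Finset ι} {i : ι} (h : σ.next S (bestWage w y S) = some i) :
    step w σ y S = insert i S := by
  simp [step, h]

theorem step_eq_of_none {S : Finset ι} (h : σ.next S (bestWage w y S) = none) :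
    step w σ y S = S := by
  simp [step, h]

theorem wage_zero_le_bestWage (S : Finset ι) : w.wage 0 ≤ bestWage w y S := le_max_left _ _

theorem wage_le_bestWage {S : Finset ι} {i : ι} (h : i ∈ S) : w.wage (y i) ≤ bestWage w y S :=
  le_max_of_le_right (Finset.le_sup (f := fun i => w.wage (y i)) h)

theorem measurable_bestWage (S : Finset ι) : Measurable fun y : ι → ℝ≥0 => bestWage w y S := by
  classical
  unfold bestWage
  refine measurable_const.max ?_
  induction S using Finset.induction_on with
  | empty => simp
  | insert i S _ ih =>
    simp only [Finset.sup_insert]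
    exact (w.measurable_wage.comp (measurable_pi_apply i)).max ih

theorem subset_step (S : Finset ι) : S ⊆ step w σ y S := by
  classical
  rcases h : σ.next S (bestWage w y S) with _ | i
  · rw [step_eq_of_none h]
  · rw [step_eq_of_some h]
    exact Finset.subset_insert _ _

variable [Fintype ι]

open Classical in
/-- Induction along the path of the search. -/
theorem sampled_induction {p : Finset ι → Prop} (h0 : p ∅)
    (hs : ∀ S i, p S → σ.next S (bestWage w y S) = some i → p (insert i S)) :
    p (sampled w σ y) := by
  have h : ∀ n, p ((step w σ y)^[n] ∅) := by
    intro n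
    induction n with
    | zero => exact h0
    | succ n ih =>
      rw [Function.iterate_succ_apply']
      rcases h : σ.next _ (bestWage w y ((step w σ y)^[n] ∅)) with _ | i
      · rwa [step_eq_of_none h]
      · rw [step_eq_of_some h]
        exact hs _ _ ih h
  exact h _

/-- The search has stopped after as many steps as there are projects. -/
theorem next_sampled : σ.next (sampled w σ y) (bestWage w y (sampled w σ y)) = none := by
  classical
  -- Each step that does not stop adds a fresh project, so a search still running after `n` steps
  -- has sampled at least `n` projects.
  have h : ∀ n, σ.next ((step w σ y)^[n] ∅) (bestWage w y ((step w σ y)^[n] ∅)) = none ∨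
      n ≤ ((step w σ y)^[n] ∅).card := by
    intro n
    induction n with
    | zero => simp
    | succ n ih =>
      rw [Function.iterate_succ_apply']
      rcases h : σ.next _ (bestWage w y ((step w σ y)^[n] ∅)) with _ | i
      · rw [step_eq_of_none h]
        exact Or.inl h
      · have hn := ih.resolve_left (by simp [h])
        rw [step_eq_of_some h, Finset.card_insert_of_notMem (σ.fresh _ _ _ h)]
        exact Or.inr (by omega)
  rcases h (Fintype.card ι) with h | h
  · exact h
  · have hu : sampled w σ y = Finset.univ := Finset.card_eq_iff_eq_univ _ |>.1
      (le_antisymm (Finset.card_le_univ _) h)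
    rcases hn : σ.next (sampled w σ y) (bestWage w y (sampled w σ y)) with _ | i
    · rfl
    · exact absurd (by simp [hu]) (σ.fresh _ _ _ hn)

theorem prize_eq_zero_or : prize w σ y = 0 ∨ ∃ i ∈ sampled w σ y, prize w σ y = y i := by
  classical
  unfold prize
  rcases Finset.eq_empty_or_nonempty
    ((sampled w σ y).filter fun i => w.wage (y i) = bestWage w y (sampled w σ y)) with h | h
  · left; rw [h]; rfl
  · right
    obtain ⟨i, hi, he⟩ := Finset.exists_mem_eq_sup _ h y
    exact ⟨i, (Finset.mem_filter.1 hi).1, he⟩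

theorem wage_prize : w.wage (prize w σ y) = bestWage w y (sampled w σ y) := by
  classical
  unfold prize
  rcases Finset.eq_empty_or_nonempty
    ((sampled w σ y).filter fun i => w.wage (y i) = bestWage w y (sampled w σ y)) with h | h
  · rw [h, Finset.sup_empty]
    change w.wage 0 = _
    rcases (sampled w σ y).eq_empty_or_nonempty with hS | hS
    · simp [hS, bestWage]
    · obtain ⟨i, hi, he⟩ := Finset.exists_mem_eq_sup _ hS fun i => w.wage (y i)
      have hne : w.wage (y i) ≠ bestWage w y (sampled w σ y) := fun hc => by
        have : i ∈ (∅ : Finset ι) := h ▸ Finset.mem_filter.2 ⟨hi, hc⟩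
        simp at this
      rw [bestWage, he] at hne ⊢
      rcases max_choice (w.wage 0) (w.wage (y i)) with h' | h'
      · exact h'.symm
      · exact absurd h'.symm hne
  · obtain ⟨i, hi, he⟩ := Finset.exists_mem_eq_sup _ h y
    rw [he]
    exact (Finset.mem_filter.1 hi).2

theorem le_prize {i : ι} (hi : i ∈ sampled w σ y)
    (h : w.wage (y i) = bestWage w y (sampled w σ y)) : y i ≤ prize w σ y := by
  classical
  exact Finset.le_sup (f := y) (Finset.mem_filter.2 ⟨hi, h⟩)

open Classical in
/-- Whether a project is sampled does not depend on its prize. -/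
theorem mem_sampled_update (i : ι) (t : ℝ≥0) :
    i ∈ sampled w σ (Function.update y i t) ↔ i ∈ sampled w σ y := by
  set y' := Function.update y i t
  -- The two paths coincide until `i` is sampled; from then on both contain `i`.
  have h : ∀ n, ((step w σ y')^[n] ∅ = (step w σ y)^[n] ∅ ∧ i ∉ (step w σ y)^[n] ∅) ∨
      (i ∈ (step w σ y')^[n] ∅ ∧ i ∈ (step w σ y)^[n] ∅) := by
    intro n
    induction n with
    | zero => simp
    | succ n ih =>
      rw [Function.iterate_succ_apply', Function.iterate_succ_apply']
      rcases ih with ⟨he, hi⟩ | ⟨h1, h2⟩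
      · have hb : bestWage w y' ((step w σ y)^[n] ∅) = bestWage w y ((step w σ y)^[n] ∅) := by
          unfold bestWage
          congr 1
          refine Finset.sup_congr rfl fun j hj => ?_
          have hji : j ≠ i := by rintro rfl; exact hi hj
          simp only [y', Function.update_of_ne hji]
        have hs : step w σ y' ((step w σ y)^[n] ∅) = step w σ y ((step w σ y)^[n] ∅) := by
          simp only [step, hb]
        rw [he, hs]
        by_cases hm : i ∈ step w σ y ((step w σ y)^[n] ∅)
        · exact Or.inr ⟨hm, hm⟩
        · exact Or.inl ⟨rfl, hm⟩
      · exact Or.inr ⟨subset_step _ h1, subset_step _ h2⟩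
  rcases h (Fintype.card ι) with ⟨h1, h2⟩ | ⟨h1, h2⟩
  · unfold sampled
    rw [h1]
  · exact iff_of_true h1 h2

end Paths

/-! ### Measurability of the path and of the prize -/

section Measurability

variable {ι : Type*} [Fintype ι] {w : Contract} {σ : Strategy ι}

theorem measurableSet_step_eq (S T : Finset ι) : MeasurableSet {y | step w σ y S = T} := by
  classical
  have h : {y | step w σ y S = T} = ⋃ o : Option ι,
      {y : ι → ℝ≥0 | σ.next S (bestWage w y S) = o} ∩
        {_y | (match o with | none => S | some i => insert i S) = T} := by
    ext y
    simp only [Set.mem_ofPred_eq, Set.mem_iUnion, Set.mem_inter_iff, exists_eq_left']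
    rcases h : σ.next S (bestWage w y S) with _ | i
    · rw [step_eq_of_none h]
    · rw [step_eq_of_some h]
  rw [h]
  refine MeasurableSet.iUnion fun o => ?_
  exact (measurable_bestWage S (σ.measurable_next S o)).inter (MeasurableSet.const _)

theorem measurableSet_sampled_eq (T : Finset ι) : MeasurableSet {y | sampled w σ y = T} := by
  classical
  have h : ∀ n T, MeasurableSet {y | (step w σ y)^[n] ∅ = T} := by
    intro n
    induction n with
    | zero => intro T; exact MeasurableSet.const (∅ = T)
    | succ n ih =>
      intro T
      have he : {y | (step w σ y)^[n + 1] ∅ = T} = ⋃ S : Finset ι,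
          {y | (step w σ y)^[n] ∅ = S} ∩ {y | step w σ y S = T} := by
        ext y
        simp [Function.iterate_succ_apply']
      rw [he]
      exact MeasurableSet.iUnion fun S => (ih S).inter (measurableSet_step_eq S T)
  exact h _ T

theorem measurableSet_mem_sampled (i : ι) : MeasurableSet {y | i ∈ sampled w σ y} := by
  classical
  have h : {y | i ∈ sampled w σ y} = ⋃ T : Finset ι,
      {y | sampled w σ y = T} ∩ {_y | i ∈ T} := by
    ext y
    simp
  rw [h]
  exact MeasurableSet.iUnion fun T => (measurableSet_sampled_eq T).inter (MeasurableSet.const _)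

theorem measurable_prize : Measurable fun y => prize w σ y := by
  classical
  -- A supremum over a random set becomes one over all projects with an indicator; `wage_prize` then
  -- removes the circular reference to the prize.
  have h : (fun y => prize w σ y) = fun y => (Finset.univ : Finset ι).sup fun i =>
      if i ∈ sampled w σ y ∧ w.wage (y i) = w.wage (prize w σ y) then y i else 0 := by
    funext y
    refine le_antisymm ?_ (Finset.sup_le fun i _ => ?_)
    · rcases prize_eq_zero_or (w := w) (σ := σ) (y := y) with h | ⟨i, hi, h⟩
      · rw [h]
        exact zero_le
      · refine le_trans ?_ (Finset.le_sup (Finset.mem_univ i))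
        rw [if_pos ⟨hi, by rw [← h]⟩, h]
    · split_ifs with h
      · exact le_prize h.1 (h.2.trans wage_prize)
      · exact zero_le
  have hb : Measurable fun y => bestWage w y (sampled w σ y) := by
    intro s hs
    have he : (fun y => bestWage w y (sampled w σ y)) ⁻¹' s = ⋃ T : Finset ι,
        {y | sampled w σ y = T} ∩ (fun y => bestWage w y T) ⁻¹' s := by
      ext y
      simp
    rw [he]
    exact MeasurableSet.iUnion fun T =>
      (measurableSet_sampled_eq T).inter (measurable_bestWage T hs)
  rw [h]
  simp only [wage_prize]
  have hsup : ∀ S : Finset ι, Measurable fun y => S.sup fun i =>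
      if i ∈ sampled w σ y ∧ w.wage (y i) = bestWage w y (sampled w σ y) then y i else 0 := by
    intro S
    induction S using Finset.induction_on with
    | empty => simp
    | insert i S _ ih =>
      simp only [Finset.sup_insert]
      refine Measurable.max (Measurable.ite ?_ (measurable_pi_apply i) measurable_const) ih
      exact (measurableSet_mem_sampled i).inter
        (measurableSet_eq_fun (w.measurable_wage.comp (measurable_pi_apply i)) hb)
  exact hsup _

end Measurability

/-! ### Independence and the capped-value upper bound -/

section Expectations

variable {ι : Type*} [Fintype ι] {w : Contract} {σ : Strategy ι} {a : ι → Project}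

instance (a : ι → Project) : IsProbabilityMeasure (law a) := by
  unfold law
  infer_instance

/-- The probability that a project is sampled. -/
noncomputable def sampleProb (a : ι → Project) (w : Contract) (σ : Strategy ι) (i : ι) : ℝ≥0 :=
  (law a {y | i ∈ sampled w σ y}).toNNReal

theorem coe_sampleProb (i : ι) :
    (sampleProb a w σ i : ℝ≥0∞) = law a {y | i ∈ sampled w σ y} :=
  ENNReal.coe_toNNReal (measure_ne_top _ _)

theorem sampleProb_le_one (i : ι) : sampleProb a w σ i ≤ 1 := by
  rw [← ENNReal.coe_le_coe, coe_sampleProb]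
  exact prob_le_one

theorem lintegral_law_eval (i : ι) {f : ℝ≥0 → ℝ≥0∞} (hf : Measurable f) :
    ∫⁻ y, f (y i) ∂law a = ∫⁻ t, f t ∂(a i).dist :=
  (measurePreserving_eval (fun i => (a i).dist) i).lintegral_comp hf

theorem ae_law_eval (i : ι) {p : ℝ≥0 → Prop} (hp : ∀ᵐ t ∂(a i).dist, p t) :
    ∀ᵐ y ∂law a, p (y i) :=
  (measurePreserving_eval (fun i => (a i).dist) i).quasiMeasurePreserving.ae hp

/-- The event that project `i` is sampled is independent of the prize of project `i`. -/
theorem lintegral_indicator_sampled (i : ι) {f : ℝ≥0 → ℝ≥0∞} (hf : Measurable f) :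
    ∫⁻ y, {y | i ∈ sampled w σ y}.indicator (fun y => f (y i)) y ∂law a =
      sampleProb a w σ i * ∫⁻ t, f t ∂(a i).dist := by
  classical
  set E := {y | i ∈ sampled w σ y} with hE
  have hEm : MeasurableSet E := measurableSet_mem_sampled i
  set c := ∫⁻ t, f t ∂(a i).dist
  have h1 : Measurable (E.indicator fun y => f (y i)) :=
    (hf.comp (measurable_pi_apply i)).indicator hEm
  have h2 : Measurable (E.indicator fun _ => c) := measurable_const.indicator hEm
  have hmem : ∀ x t, Function.update x i t ∈ E ↔ x ∈ E := fun x t => mem_sampled_update i t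
  -- Integrating out coordinate `i` first gives the same result on both sides, since the event does
  -- not move with that coordinate.
  have key := lmarginal_eq_of_subset (μ := fun i => (a i).dist) (Finset.subset_univ {i}) h1 h2 (by
    rw [lmarginal_singleton, lmarginal_singleton]
    funext x
    by_cases hx : x ∈ E
    · simp [Set.indicator, hmem, hx, c]
    · simp [Set.indicator, hmem, hx])
  rw [lmarginal_univ, lmarginal_univ] at key
  have := congrFun key 0
  unfold law
  rw [this, lintegral_indicator hEm, lintegral_const, Measure.restrict_apply_univ, coe_sampleProb,
    mul_comm]
  rfl

theorem lintegral_sum_sampled {f : ι → ℝ≥0 → ℝ≥0∞} (hf : ∀ i, Measurable (f i)) :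
    ∫⁻ y, ∑ i ∈ sampled w σ y, f i (y i) ∂law a =
      ∑ i, sampleProb a w σ i * ∫⁻ t, f i t ∂(a i).dist := by
  classical
  have h : ∀ y : ι → ℝ≥0, ∑ i ∈ sampled w σ y, f i (y i) =
      ∑ i, {y | i ∈ sampled w σ y}.indicator (fun y => f i (y i)) y := by
    intro y
    simp [Set.indicator]
  simp_rw [h]
  rw [lintegral_finsetSum]
  · exact Finset.sum_congr rfl fun i _ => lintegral_indicator_sampled i (hf i)
  · intro i _
    exact ((hf i).comp (measurable_pi_apply i)).indicator (measurableSet_mem_sampled i)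

theorem expCost_eq : expCost a w σ = ((∑ i, sampleProb a w σ i * (a i).cost : ℝ≥0) : ℝ≥0∞) := by
  unfold expCost
  have := lintegral_sum_sampled (a := a) (w := w) (σ := σ)
    (f := fun i _ => ((a i).cost : ℝ≥0∞)) (fun _ => measurable_const)
  simp only [lintegral_const, measure_univ, mul_one] at this
  push_cast
  exact this

/-- The largest capped value `min (h (y i)) (ρ i)`, with outside option `h 0`. -/
noncomputable def cappedMax (h : ℝ≥0 → ℝ≥0) (ρ : ι → ℝ≥0∞) (y : ι → ℝ≥0) : ℝ≥0∞ :=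
  max (h 0 : ℝ≥0∞) (Finset.univ.sup fun i => min (h (y i) : ℝ≥0∞) (ρ i))

theorem measurable_cappedMax {h : ℝ≥0 → ℝ≥0} (hh : Measurable h) (ρ : ι → ℝ≥0∞) :
    Measurable (cappedMax h ρ) := by
  classical
  refine measurable_const.max ?_
  have : ∀ S : Finset ι, Measurable fun y : ι → ℝ≥0 =>
      S.sup fun i => min (h (y i) : ℝ≥0∞) (ρ i) := by
    intro S
    induction S using Finset.induction_on with
    | empty => simp
    | insert i S _ ih =>
      simp only [Finset.sup_insert]
      exact ((hh.comp (measurable_pi_apply i)).coe_nnreal_ennreal.min measurable_const).max ih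
  exact this _

/-- The presented `h (y i)` is its capped part, which `cappedMax` dominates, plus its excess, which
is one of the summands. `h` need not be the wage that guides the search. -/
theorem value_prize_le (h : ℝ≥0 → ℝ≥0) (ρ : ι → ℝ≥0∞) (y : ι → ℝ≥0) :
    (h (prize w σ y) : ℝ≥0∞) ≤
      cappedMax h ρ y + ∑ i ∈ sampled w σ y, ((h (y i) : ℝ≥0∞) - ρ i) := by
  rcases prize_eq_zero_or (w := w) (σ := σ) (y := y) with h0 | ⟨i, hi, h0⟩
  · rw [h0]
    exact le_add_right (le_max_left _ _)
  · rw [h0]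
    have h1 : min (h (y i) : ℝ≥0∞) (ρ i) ≤ cappedMax h ρ y :=
      le_max_of_le_right
        (Finset.le_sup (f := fun i => min (h (y i) : ℝ≥0∞) (ρ i)) (Finset.mem_univ i))
    have h2 : (h (y i) : ℝ≥0∞) - ρ i ≤ ∑ i ∈ sampled w σ y, ((h (y i) : ℝ≥0∞) - ρ i) :=
      Finset.single_le_sum (f := fun i => (h (y i) : ℝ≥0∞) - ρ i) (fun _ _ => zero_le) hi
    refine le_trans ?_ (add_le_add h1 h2)
    rcases le_total (h (y i) : ℝ≥0∞) (ρ i) with h3 | h3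
    · rw [min_eq_left h3]
      exact le_self_add
    · rw [min_eq_right h3, add_tsub_cancel_of_le h3]

/-- Capped values bound the expected value of the presented prize. -/
theorem lintegral_value_prize_le {h : ℝ≥0 → ℝ≥0} (hh : Measurable h) (ρ : ι → ℝ≥0∞) :
    ∫⁻ y, (h (prize w σ y) : ℝ≥0∞) ∂law a ≤ ∫⁻ y, cappedMax h ρ y ∂law a +
      ∑ i, sampleProb a w σ i * ∫⁻ t, ((h t : ℝ≥0∞) - ρ i) ∂(a i).dist := by
  rw [← lintegral_sum_sampled (f := fun i t => (h t : ℝ≥0∞) - ρ i)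
    (fun i => hh.coe_nnreal_ennreal.sub_const _),
    ← lintegral_add_left (measurable_cappedMax hh ρ)]
  exact lintegral_mono fun y => value_prize_le h ρ y

theorem lintegral_value_prize_le_cost {h : ℝ≥0 → ℝ≥0} (hh : Measurable h) {ρ : ι → ℝ≥0∞}
    (hρ : ∀ i, ∫⁻ t, ((h t : ℝ≥0∞) - ρ i) ∂(a i).dist ≤ (a i).cost) :
    ∫⁻ y, (h (prize w σ y) : ℝ≥0∞) ∂law a ≤
      ∫⁻ y, cappedMax h ρ y ∂law a + expCost a w σ := by
  refine (lintegral_value_prize_le hh ρ).trans (add_le_add le_rfl ?_)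
  rw [expCost_eq]
  push_cast
  exact Finset.sum_le_sum fun i _ => mul_le_mul_right (hρ i) _

/-- A common cap `C ≥ h 0` bounds `cappedMax` by `C`. The result is linear in the sampling
probabilities, which suits examples with one or two projects. -/
theorem lintegral_value_prize_le_const {h : ℝ≥0 → ℝ≥0} (hh : Measurable h) {C : ℝ≥0}
    (hC : h 0 ≤ C) :
    ∫⁻ y, (h (prize w σ y) : ℝ≥0∞) ∂law a ≤ C +
      ∑ i, sampleProb a w σ i * ∫⁻ t, ((h t : ℝ≥0∞) - C) ∂(a i).dist := by
  refine (lintegral_value_prize_le hh fun _ => (C : ℝ≥0∞)).trans (add_le_add ?_ le_rfl)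
  calc ∫⁻ y, cappedMax h (fun _ => (C : ℝ≥0∞)) y ∂law a ≤ ∫⁻ _, (C : ℝ≥0∞) ∂law a :=
        lintegral_mono fun y => max_le (ENNReal.coe_le_coe.2 hC)
          (Finset.sup_le fun i _ => min_le_right _ _)
    _ = C := by simp

end Expectations

/-! ### The index policy and its optimality -/

section Policy

variable {ι : Type*} {I : Finset ι} {ρ : ι → ℝ≥0∞}

open Classical in
/-- The unsampled eligible project with the highest index, if there is one. -/
noncomputable def topProject (I : Finset ι) (ρ : ι → ℝ≥0∞) (S : Finset ι) : Option ι :=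
  if h : (I \ S).Nonempty then some (Finset.exists_max_image (I \ S) ρ h).choose else none

open Classical in
theorem topProject_spec {S : Finset ι} {i : ι} (h : topProject I ρ S = some i) :
    i ∈ I ∧ i ∉ S ∧ ∀ j ∈ I, j ∉ S → ρ j ≤ ρ i := by
  unfold topProject at h
  split_ifs at h with hn
  have hs := (Finset.exists_max_image (I \ S) ρ hn).choose_spec
  rw [Option.some.inj h, Finset.mem_sdiff] at hs
  exact ⟨hs.1.1, hs.1.2, fun j hj hjS => hs.2 j (Finset.mem_sdiff.2 ⟨hj, hjS⟩)⟩

theorem exists_topProject {S : Finset ι} {j : ι} (hj : j ∈ I) (hjS : j ∉ S) :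
    ∃ i, topProject I ρ S = some i := by
  classical
  unfold topProject
  rw [dif_pos ⟨j, Finset.mem_sdiff.2 ⟨hj, hjS⟩⟩]
  exact ⟨_, rfl⟩

open Classical in
/-- The index policy: sample the eligible project with the highest index, as long as its index is
at least the best available wage. -/
noncomputable def indexPolicy (I : Finset ι) (ρ : ι → ℝ≥0∞) : Strategy ι where
  next S v := (topProject I ρ S).filter fun i => (v : ℝ≥0∞) ≤ ρ i
  fresh S v i h := by
    rw [Option.filter_eq_some_iff] at h
    exact (topProject_spec h.1).2.1
  measurable_next S o := by
    rcases topProject I ρ S with _ | i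
    · simp
    · have hm : MeasurableSet {v : ℝ≥0 | (v : ℝ≥0∞) ≤ ρ i} :=
        measurableSet_le measurable_coe_nnreal_ennreal measurable_const
      have he : ∀ v : ℝ≥0, (some i).filter (fun i => decide ((v : ℝ≥0∞) ≤ ρ i)) =
          if (v : ℝ≥0∞) ≤ ρ i then some i else none := fun v => by simp [Option.filter]
      simp only [he]
      exact (Measurable.ite hm measurable_const measurable_const :
        Measurable[_, ⊤] _) (MeasurableSpace.measurableSet_top (s := {o}))

theorem next_indexPolicy {S : Finset ι} {v : ℝ≥0} {i : ι}
    (h : (indexPolicy I ρ).next S v = some i) :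
    i ∈ I ∧ i ∉ S ∧ (∀ j ∈ I, j ∉ S → ρ j ≤ ρ i) ∧ (v : ℝ≥0∞) ≤ ρ i := by
  classical
  simp only [indexPolicy, Option.filter_eq_some_iff, decide_eq_true_eq] at h
  obtain ⟨h1, h2, h3⟩ := topProject_spec h.1
  exact ⟨h1, h2, h3, h.2⟩

theorem lt_of_next_indexPolicy_eq_none {S : Finset ι} {v : ℝ≥0}
    (h : (indexPolicy I ρ).next S v = none) {j : ι} (hj : j ∈ I) (hjS : j ∉ S) :
    ρ j < v := by
  classical
  obtain ⟨i, hi⟩ := exists_topProject (ρ := ρ) hj hjS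
  simp only [indexPolicy, hi, Option.filter_eq_none_iff] at h
  have := h i rfl
  simp only [decide_eq_true_eq, not_le] at this
  exact ((topProject_spec hi).2.2 j hj hjS).trans_lt this

variable [Fintype ι] {w : Contract} {y : ι → ℝ≥0}

theorem index_lt_of_notMem_sampled {j : ι} (hj : j ∈ I)
    (h : j ∉ sampled w (indexPolicy I ρ) y) :
    ρ j < w.wage (prize w (indexPolicy I ρ) y) := by
  rw [wage_prize]
  exact lt_of_next_indexPolicy_eq_none next_sampled hj h

theorem sampled_indexPolicy_subset : sampled w (indexPolicy I ρ) y ⊆ I := by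
  classical
  refine sampled_induction (p := fun S => S ⊆ I) (Finset.empty_subset _) fun S i hS hi => ?_
  exact Finset.insert_subset (next_indexPolicy hi).1 hS

/-- Under the index policy, a project whose wage exceeds its index ends the search. -/
theorem sampled_indexPolicy_spec : ∀ i ∈ sampled w (indexPolicy I ρ) y, ρ i < w.wage (y i) →
    (w.wage 0 : ℝ≥0∞) ≤ ρ i ∧
    (∀ j ∈ sampled w (indexPolicy I ρ) y, j ≠ i → (w.wage (y j) : ℝ≥0∞) ≤ ρ i) ∧
    ∀ j ∈ I, j ∉ sampled w (indexPolicy I ρ) y → ρ j ≤ ρ i := by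
  classical
  refine sampled_induction (p := fun S => ∀ i ∈ S, ρ i < w.wage (y i) →
    (w.wage 0 : ℝ≥0∞) ≤ ρ i ∧ (∀ j ∈ S, j ≠ i → (w.wage (y j) : ℝ≥0∞) ≤ ρ i) ∧
    ∀ j ∈ I, j ∉ S → ρ j ≤ ρ i) (by simp) fun S k hS hk i hi hlt => ?_
  obtain ⟨hkI, hkS, hmax, hv⟩ := next_indexPolicy hk
  rcases Finset.mem_insert.1 hi with rfl | hi
  · refine ⟨le_trans (ENNReal.coe_le_coe.2 (wage_zero_le_bestWage S)) hv, fun j hj hji => ?_,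
      fun j hj hjS => hmax j hj fun h => hjS (Finset.mem_insert_of_mem h)⟩
    exact le_trans (ENNReal.coe_le_coe.2
      (wage_le_bestWage ((Finset.mem_insert.1 hj).resolve_left hji))) hv
  -- The project `k` sampled next has index at most `ρ i`, so the wage in hand is at most `ρ i`: an
  -- earlier excess over `ρ i` would have stopped the search.
  · have h1 := (hS i hi hlt).2.2 k hkI hkS
    have h2 : (w.wage (y i) : ℝ≥0∞) ≤ bestWage w y S :=
      ENNReal.coe_le_coe.2 (wage_le_bestWage hi)
    exact absurd hlt (not_lt.2 (h2.trans (hv.trans h1)))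

/-- The index policy attains the bound by capped wages. -/
theorem cappedMax_add_le (hI : ∀ i ∉ I, ρ i = 0) :
    cappedMax w.wage ρ y +
      ∑ i ∈ sampled w (indexPolicy I ρ) y, ((w.wage (y i) : ℝ≥0∞) - ρ i) ≤
      w.wage (prize w (indexPolicy I ρ) y) := by
  classical
  set S := sampled w (indexPolicy I ρ) y with hS
  have hV : w.wage (prize w (indexPolicy I ρ) y) = bestWage w y S := wage_prize
  have hleV : ∀ i ∈ S, (w.wage (y i) : ℝ≥0∞) ≤ w.wage (prize w (indexPolicy I ρ) y) :=
    fun i hi => by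
      rw [hV]
      exact ENNReal.coe_le_coe.2 (wage_le_bestWage hi)
  -- At most one sampled wage exceeds its index. If there is one, every capped wage is at most `ρ
  -- i`, and the excess tops this up to `w.wage (y i)`.
  by_cases hex : ∃ i ∈ S, ρ i < w.wage (y i)
  · obtain ⟨i, hi, hlt⟩ := hex
    obtain ⟨h0, h1, h2⟩ := sampled_indexPolicy_spec i hi hlt
    have hM : cappedMax w.wage ρ y ≤ ρ i := by
      refine max_le h0 (Finset.sup_le fun j _ => ?_)
      by_cases hji : j = i
      · rw [hji]
        exact min_le_right _ _
      by_cases hjS : j ∈ S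
      · exact (min_le_left _ _).trans (h1 j hjS hji)
      by_cases hjI : j ∈ I
      · exact (min_le_right _ _).trans (h2 j hjI hjS)
      · rw [hI j hjI]
        simp
    have hsum : ∑ j ∈ S, ((w.wage (y j) : ℝ≥0∞) - ρ j) = w.wage (y i) - ρ i := by
      refine Finset.sum_eq_single_of_mem i hi fun j hj hji => ?_
      rw [tsub_eq_zero_iff_le]
      -- Two excesses would give the cycle `w (y j) ≤ ρ i < w (y i) ≤ ρ j < w (y j)`.
      by_contra hc
      have h3 := (sampled_indexPolicy_spec j hj (not_le.1 hc)).2.1 i hi (Ne.symm hji)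
      exact hc ((h1 j hj hji).trans (hlt.le.trans h3))
    rw [hsum]
    calc _ ≤ ρ i + (w.wage (y i) - ρ i) := add_le_add hM le_rfl
      _ = w.wage (y i) := add_tsub_cancel_of_le hlt.le
      _ ≤ _ := hleV i hi
  · push Not at hex
    have hsum : ∑ j ∈ S, ((w.wage (y j) : ℝ≥0∞) - ρ j) = 0 :=
      Finset.sum_eq_zero fun j hj => tsub_eq_zero_iff_le.2 (hex j hj)
    rw [hsum, add_zero]
    refine max_le ?_ (Finset.sup_le fun j _ => ?_)
    · rw [hV]
      exact ENNReal.coe_le_coe.2 (wage_zero_le_bestWage S)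
    by_cases hjS : j ∈ S
    · exact (min_le_left _ _).trans (hleV j hjS)
    by_cases hjI : j ∈ I
    · exact (min_le_right _ _).trans (index_lt_of_notMem_sampled hjI hjS).le
    · rw [hI j hjI]
      simp

/-- A system of indices for the value function `h`: the eligible projects are fairly capped and
the others are not worth sampling. -/
structure IsIndexSystem (a : ι → Project) (h : ℝ≥0 → ℝ≥0) (I : Finset ι) (ρ : ι → ℝ≥0∞) :
    Prop where
  eq_cost : ∀ i ∈ I, ∫⁻ t, ((h t : ℝ≥0∞) - ρ i) ∂(a i).dist = (a i).cost
  le_cost : ∀ i, ∫⁻ t, ((h t : ℝ≥0∞) - ρ i) ∂(a i).dist ≤ (a i).cost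
  eq_zero : ∀ i ∉ I, ρ i = 0

variable {a : ι → Project}

theorem le_expWage_indexPolicy (hs : IsIndexSystem a w.wage I ρ) :
    ∫⁻ y, cappedMax w.wage ρ y ∂law a + expCost a w (indexPolicy I ρ) ≤
      expWage a w (indexPolicy I ρ) := by
  have h1 : expCost a w (indexPolicy I ρ) =
      ∫⁻ y, ∑ i ∈ sampled w (indexPolicy I ρ) y, ((w.wage (y i) : ℝ≥0∞) - ρ i) ∂law a := by
    rw [lintegral_sum_sampled (f := fun i t => (w.wage t : ℝ≥0∞) - ρ i)
      fun i => w.measurable_wage.coe_nnreal_ennreal.sub_const _, expCost_eq]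
    push_cast
    refine Finset.sum_congr rfl fun i _ => ?_
    by_cases hi : i ∈ I
    · rw [hs.eq_cost i hi]
    · have : sampleProb a w (indexPolicy I ρ) i = 0 := by
        have he : {y | i ∈ sampled w (indexPolicy I ρ) y} = ∅ :=
          Set.eq_empty_of_forall_notMem fun y hy => hi (sampled_indexPolicy_subset hy)
        rw [sampleProb, he]
        simp
      simp [this]
  rw [h1, ← lintegral_add_left (measurable_cappedMax w.measurable_wage ρ)]
  exact lintegral_mono fun y => cappedMax_add_le hs.eq_zero

theorem expCost_ne_top {σ : Strategy ι} : expCost a w σ ≠ ⊤ := by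
  rw [expCost_eq]
  exact ENNReal.coe_ne_top

/-- Expected wages may be infinite but costs are not; this moves payoff comparisons to sums in
`ℝ≥0∞`. -/
theorem EReal_sub_le_sub_iff {A B C D : ℝ≥0∞} (hC : C ≠ ⊤) (hD : D ≠ ⊤) :
    (A : EReal) - (C : EReal) ≤ (B : EReal) - (D : EReal) ↔ A + D ≤ B + C := by
  lift C to ℝ≥0 using hC
  lift D to ℝ≥0 using hD
  have hD' : ((D : ℝ≥0∞) : EReal) = ((D : ℝ) : EReal) := rfl
  have hC' : ((C : ℝ≥0∞) : EReal) = ((C : ℝ) : EReal) := rfl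
  induction A with
  | top =>
    induction B with
    | top => simp
    | coe B =>
      have hB' : ((B : ℝ≥0∞) : EReal) = ((B : ℝ) : EReal) := rfl
      rw [hB', hC', hD', ← EReal.coe_sub]
      simp only [EReal.coe_ennreal_top, EReal.top_sub_coe, top_le_iff, top_add]
      constructor
      · intro h; exact absurd h (EReal.coe_ne_top _)
      · intro h; exact absurd h (by simp)
  | coe A =>
    have hA' : ((A : ℝ≥0∞) : EReal) = ((A : ℝ) : EReal) := rfl
    induction B with
    | top => simp [hD']
    | coe B =>
      have hB' : ((B : ℝ≥0∞) : EReal) = ((B : ℝ) : EReal) := rfl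
      rw [hA', hB', hC', hD', ← EReal.coe_sub, ← EReal.coe_sub, EReal.coe_le_coe_iff,
        ← ENNReal.coe_add, ← ENNReal.coe_add, ENNReal.coe_le_coe, ← NNReal.coe_le_coe]
      push_cast
      constructor <;> intro h <;> linarith

theorem indexPolicy_mem_optimalStrategies (hs : IsIndexSystem a w.wage I ρ) :
    indexPolicy I ρ ∈ optimalStrategies a w := by
  intro τ
  rw [agentPayoff, agentPayoff, EReal_sub_le_sub_iff expCost_ne_top expCost_ne_top]
  calc expWage a w τ + expCost a w (indexPolicy I ρ)
      ≤ (∫⁻ y, cappedMax w.wage ρ y ∂law a + expCost a w τ) + expCost a w (indexPolicy I ρ) :=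
        add_le_add (lintegral_value_prize_le_cost w.measurable_wage hs.le_cost) le_rfl
    _ = (∫⁻ y, cappedMax w.wage ρ y ∂law a + expCost a w (indexPolicy I ρ)) + expCost a w τ := by
        ring
    _ ≤ _ := add_le_add (le_expWage_indexPolicy hs) le_rfl

end Policy

/-! ### Existence of indices -/

section Existence

/-- A project worth sampling has an index: a cap that makes sampling it exactly fair. -/
theorem exists_index {μ : Measure ℝ≥0} [IsProbabilityMeasure μ] {h : ℝ≥0 → ℝ≥0}
    (hh : Measurable h) (hfin : ∫⁻ t, (h t : ℝ≥0∞) ∂μ ≠ ⊤) {c : ℝ≥0}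
    (hc : (c : ℝ≥0∞) ≤ ∫⁻ t, (h t : ℝ≥0∞) ∂μ) :
    ∃ r : ℝ≥0∞, ∫⁻ t, ((h t : ℝ≥0∞) - r) ∂μ = c := by
  rcases eq_or_ne c 0 with rfl | hc0
  -- A free project may have an unbounded prize, so only an infinite cap is always fair.
  · exact ⟨⊤, by simp⟩
  have hcont : Continuous fun r : ℝ≥0 => ∫⁻ t, ((h t : ℝ≥0∞) - r) ∂μ := by
    refine continuous_iff_continuousAt.2 fun r => ?_
    refine tendsto_lintegral_filter_of_dominated_convergence (fun t => (h t : ℝ≥0∞))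
      (Filter.Eventually.of_forall fun r => hh.coe_nnreal_ennreal.sub_const _)
      (Filter.Eventually.of_forall fun r => Filter.Eventually.of_forall fun t => tsub_le_self)
      hfin (Filter.Eventually.of_forall fun t => ?_)
    have : Continuous fun r : ℝ≥0 => ((h t - r : ℝ≥0) : ℝ≥0∞) :=
      ENNReal.continuous_coe.comp (continuous_const.sub continuous_id)
    simpa using this.tendsto r
  have hlim : Filter.Tendsto (fun r : ℝ≥0 => ∫⁻ t, ((h t : ℝ≥0∞) - r) ∂μ) Filter.atTop
      (nhds 0) := by
    have := tendsto_lintegral_filter_of_dominated_convergence (μ := μ)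
      (F := fun (r : ℝ≥0) t => (h t : ℝ≥0∞) - r) (f := fun _ => 0) (l := Filter.atTop)
      (fun t => (h t : ℝ≥0∞))
      (Filter.Eventually.of_forall fun r => hh.coe_nnreal_ennreal.sub_const _)
      (Filter.Eventually.of_forall fun r => Filter.Eventually.of_forall fun t => tsub_le_self)
      hfin (Filter.Eventually.of_forall fun t => tendsto_const_nhds.congr' ?_)
    · simpa using this
    · filter_upwards [Filter.eventually_ge_atTop (h t)] with r hr
      exact (tsub_eq_zero_of_le (ENNReal.coe_le_coe.2 hr)).symm
  obtain ⟨R, hR⟩ := (hlim.eventually_lt_const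
    (show (0 : ℝ≥0∞) < c by exact_mod_cast pos_iff_ne_zero.2 hc0)).exists
  obtain ⟨r, _, hr⟩ := intermediate_value_Icc' (zero_le : 0 ≤ R) hcont.continuousOn
    ⟨hR.le, by simpa using hc⟩
  exact ⟨r, hr⟩

variable {ι : Type*} [Fintype ι]

-- Projects that just break even count as eligible, which matters for the known project under the
-- optimal debt. For the others the cap `0` already leaves an expected excess below the cost.
open Classical in
theorem exists_isIndexSystem (a : ι → Project) {h : ℝ≥0 → ℝ≥0} (hh : Measurable h)
    (hfin : ∀ i, ∫⁻ t, (h t : ℝ≥0∞) ∂(a i).dist ≠ ⊤) :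
    ∃ ρ, IsIndexSystem a h
      (Finset.univ.filter fun i => ((a i).cost : ℝ≥0∞) ≤ ∫⁻ t, (h t : ℝ≥0∞) ∂(a i).dist) ρ := by
  have hex : ∀ i, ∃ r : ℝ≥0∞,
      (((a i).cost : ℝ≥0∞) ≤ ∫⁻ t, (h t : ℝ≥0∞) ∂(a i).dist →
        ∫⁻ t, ((h t : ℝ≥0∞) - r) ∂(a i).dist = (a i).cost) ∧
      (¬((a i).cost : ℝ≥0∞) ≤ ∫⁻ t, (h t : ℝ≥0∞) ∂(a i).dist → r = 0) := by
    intro i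
    by_cases hc : ((a i).cost : ℝ≥0∞) ≤ ∫⁻ t, (h t : ℝ≥0∞) ∂(a i).dist
    · obtain ⟨r, hr⟩ := exists_index hh (hfin i) hc
      exact ⟨r, fun _ => hr, fun h => absurd hc h⟩
    · exact ⟨0, fun h => absurd h hc, fun _ => rfl⟩
  choose ρ h1 h2 using hex
  refine ⟨ρ, fun i hi => h1 i (by simpa using hi), fun i => ?_, fun i hi => h2 i (by simpa using hi)⟩
  by_cases hc : ((a i).cost : ℝ≥0∞) ≤ ∫⁻ t, (h t : ℝ≥0∞) ∂(a i).dist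
  · exact (h1 i hc).le
  · rw [h2 i hc]
    simpa using (not_le.1 hc).le

end Existence

/-! ### Extended-real arithmetic and single projects -/

theorem EReal_le_sub_iff {X B D : ℝ≥0∞} (hD : D ≠ ⊤) :
    (X : EReal) ≤ (B : EReal) - (D : EReal) ↔ X + D ≤ B := by
  simpa using EReal_sub_le_sub_iff (A := X) (B := B) (C := 0) (D := D) (by simp) hD

theorem EReal_sub_le_iff {X B D : ℝ≥0∞} (hD : D ≠ ⊤) :
    (B : EReal) - (D : EReal) ≤ (X : EReal) ↔ B ≤ X + D := by
  simpa using EReal_sub_le_sub_iff (A := B) (B := X) (C := D) (D := 0) hD (by simp)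

namespace Project

theorem exists_mean_eq (a : Project) :
    ∃ m : ℝ≥0, ∫⁻ y, (y : ℝ≥0∞) ∂a.dist = m ∧ a.mean = m := by
  lift (∫⁻ y, (y : ℝ≥0∞) ∂a.dist) to ℝ≥0 using a.finite_mean.ne with m hm
  refine ⟨m, rfl, ?_⟩
  have h := integral_toReal (μ := a.dist) (f := fun y : ℝ≥0 => (y : ℝ≥0∞))
    measurable_coe_nnreal_ennreal.aemeasurable (by simp)
  simpa [mean, ← hm] using h

theorem cost_le_lintegral {a : Project} (h : 0 ≤ a.surplus) :
    (a.cost : ℝ≥0∞) ≤ ∫⁻ y, (y : ℝ≥0∞) ∂a.dist := by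
  obtain ⟨m, h1, h2⟩ := a.exists_mean_eq
  rw [surplus, h2, sub_nonneg, NNReal.coe_le_coe] at h
  rw [h1]
  exact_mod_cast h

theorem integrable_coe (a : Project) : Integrable (fun y : ℝ≥0 => (y : ℝ)) a.dist := by
  have := integrable_toReal_of_lintegral_ne_top (μ := a.dist) (f := fun y : ℝ≥0 => (y : ℝ≥0∞))
    measurable_coe_nnreal_ennreal.aemeasurable a.finite_mean.ne
  simpa using this

theorem ae_lowest_le (a : Project) : ∀ᵐ y : ℝ≥0 ∂a.dist, a.lowest ≤ (y : ℝ) := by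
  filter_upwards [Measure.support_mem_ae (μ := a.dist)] with y hy
  exact NNReal.coe_le_coe.2 (csInf_le (OrderBot.bddBelow _) hy)

theorem not_ae_le {a : Project} {q : ℝ≥0} (hq : a.lowest < q) :
    ¬ ∀ᵐ y ∂a.dist, q ≤ y := by
  intro hae
  obtain ⟨x, hx, hxq⟩ := exists_lt_of_csInf_lt
    (Measure.nonempty_support (IsProbabilityMeasure.ne_zero a.dist)) (NNReal.coe_lt_coe.1 hq)
  have h := (Measure.mem_support_iff_forall x).1 hx (Set.Iio q) (Iio_mem_nhds hxq)
  refine h.ne' ?_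
  have he : Set.Iio q = {y | ¬ q ≤ y} := by ext; simp
  rw [he, ← ae_iff]
  exact hae

/-- The project with a sure prize. -/
noncomputable def sure (y c : ℝ≥0) : Project where
  dist := Measure.dirac y
  cost := c
  isProb := inferInstance
  finite_mean := by simp

@[simp] theorem sure_dist (y c : ℝ≥0) : (sure y c).dist = Measure.dirac y := rfl

@[simp] theorem sure_cost (y c : ℝ≥0) : (sure y c).cost = c := rfl

theorem surplus_sure (y c : ℝ≥0) : (sure y c).surplus = y - c := by
  simp [surplus, mean]

end Project

/-! ### Deviations that bound the agent's optimal payoff from below -/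

section Family

variable {ι : Type*} [Fintype ι] {a : ι → Project} {w : Contract} {σ : Strategy ι}

theorem expPrize_ne_top : expPrize a w σ ≠ ⊤ := by
  refine ne_top_of_le_ne_top ?_ (lintegral_value_prize_le_const (a := a) (w := w) (σ := σ)
    (h := fun y => y) measurable_id (C := 0) le_rfl)
  refine ENNReal.add_ne_top.2 ⟨by simp, ENNReal.sum_ne_top.2 fun i _ => ?_⟩
  exact ENNReal.mul_ne_top (by simp) (by simpa using (a i).finite_mean.ne)

/-- The strategy that never samples anything. -/
def stopStrategy : Strategy ι where
  next _ _ := none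
  fresh _ _ _ h := by simp at h
  measurable_next _ _ := MeasurableSet.const _

theorem sampled_stopStrategy (y : ι → ℝ≥0) : sampled w stopStrategy y = ∅ := by
  classical
  exact sampled_induction (p := fun S => S = ∅) rfl fun S i _ h => by simp [stopStrategy] at h

open Classical in
/-- The strategy that samples exactly the project `i`. -/
noncomputable def singleStrategy (i : ι) : Strategy ι where
  next S _ := if i ∈ S then none else some i
  fresh S _ j h := by
    split_ifs at h with hi
    rwa [← Option.some.inj h]
  measurable_next _ _ := MeasurableSet.const _

theorem sampled_singleStrategy (i : ι) (y : ι → ℝ≥0) :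
    sampled w (singleStrategy i) y = {i} := by
  classical
  refine Finset.Subset.antisymm ?_ ?_
  · refine sampled_induction (p := fun S => S ⊆ {i}) (Finset.empty_subset _) fun S j hS h => ?_
    simp only [singleStrategy] at h
    split_ifs at h with hi
    rw [← Option.some.inj h]
    exact Finset.insert_subset (Finset.mem_singleton_self i) hS
  · have h := next_sampled (w := w) (σ := singleStrategy i) (y := y)
    simp only [singleStrategy] at h
    split_ifs at h with hi
    exact Finset.singleton_subset_iff.2 hi

theorem add_expCost_le_of_optimal (hσ : σ ∈ optimalStrategies a w) :
    w.wage 0 + expCost a w σ ≤ expWage a w σ := by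
  have h := hσ stopStrategy
  rw [agentPayoff, agentPayoff, EReal_sub_le_sub_iff expCost_ne_top expCost_ne_top] at h
  simpa [expWage, expCost, wage_prize, sampled_stopStrategy, bestWage] using h

theorem lintegral_max_add_expCost_le_of_optimal (hσ : σ ∈ optimalStrategies a w) (i : ι) :
    ∫⁻ t, (max (w.wage 0) (w.wage t) : ℝ≥0) ∂(a i).dist + expCost a w σ ≤
      expWage a w σ + (a i).cost := by
  have h := hσ (singleStrategy i)
  rw [agentPayoff, agentPayoff, EReal_sub_le_sub_iff expCost_ne_top expCost_ne_top] at h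
  rw [← lintegral_law_eval (a := a) i
    (f := fun t => ((max (w.wage 0) (w.wage t) : ℝ≥0) : ℝ≥0∞))
    (measurable_const.max w.measurable_wage).coe_nnreal_ennreal]
  simpa [expWage, expCost, wage_prize, sampled_singleStrategy, bestWage] using h

end Family

/-! ### The first-best surplus -/

section FirstBest

variable {A : Finset Project}

theorem debt_zero_wage (y : ℝ≥0) : (debt 0).wage y = y := by simp [debt]

/-- `debt 0` hands over the whole prize, so the agent maximizes total surplus and reaches the
capped-value bound. -/
theorem le_totalSurplus_debt_zero {I : Finset A} {ρ : A → ℝ≥0∞}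
    (hs : IsIndexSystem (family A) (fun y => y) I ρ) :
    ((∫⁻ y, cappedMax (fun y => y) ρ y ∂law (family A) : ℝ≥0∞) : EReal) ≤
      totalSurplus (debt 0) A := by
  have hw : (debt 0).wage = fun y => y := funext debt_zero_wage
  rw [← hw] at hs ⊢
  refine le_iSup₂_of_le _ (indexPolicy_mem_optimalStrategies hs) ?_
  rw [jointPayoff, EReal_le_sub_iff expCost_ne_top]
  refine (le_expWage_indexPolicy hs).trans (le_of_eq ?_)
  simp only [expWage, expPrize, debt_zero_wage]

theorem totalSurplus_le (w : Contract) {ρ : A → ℝ≥0∞}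
    (hρ : ∀ i, ∫⁻ t, ((t : ℝ≥0∞) - ρ i) ∂(family A i).dist ≤ (family A i).cost) :
    totalSurplus w A ≤ ((∫⁻ y, cappedMax (fun y => y) ρ y ∂law (family A) : ℝ≥0∞) : EReal) := by
  refine iSup₂_le fun σ _ => ?_
  rw [jointPayoff, EReal_sub_le_iff expCost_ne_top]
  exact lintegral_value_prize_le_cost (h := fun y => y) measurable_id hρ

theorem exists_isIndexSystem_id (A : Finset Project) :
    ∃ (I : Finset A) (ρ : A → ℝ≥0∞), IsIndexSystem (family A) (fun y => y) I ρ ∧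
      ∀ i, 0 ≤ (family A i).surplus → i ∈ I := by
  classical
  obtain ⟨ρ, hρ⟩ := exists_isIndexSystem (family A) (h := fun y => y) measurable_id
    fun i => (family A i).finite_mean.ne
  exact ⟨_, ρ, hρ, fun i hi => by simpa using Project.cost_le_lintegral hi⟩

/-- `E[min y ρ] = E[y] - E[(y - ρ)⁺]`, and a fair cap makes the last term the cost. -/
theorem lintegral_capped_eq {ι : Type*} [Fintype ι] {a : ι → Project} {I : Finset ι}
    {ρ : ι → ℝ≥0∞} (hs : IsIndexSystem a (fun y => y) I ρ) {i : ι} (hi : i ∈ I) :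
    ((∫⁻ t, min (t : ℝ≥0∞) (ρ i) ∂(a i).dist : ℝ≥0∞) : EReal) = ((a i).surplus : ℝ) := by
  obtain ⟨m, h1, h2⟩ := (a i).exists_mean_eq
  have h3 : ∫⁻ t, min (t : ℝ≥0∞) (ρ i) ∂(a i).dist + (a i).cost = m := by
    rw [← hs.eq_cost i hi, ← h1, ← lintegral_add_left
      (measurable_coe_nnreal_ennreal.min measurable_const)]
    refine lintegral_congr fun t => ?_
    rcases le_total (t : ℝ≥0∞) (ρ i) with h | h
    · rw [min_eq_left h, tsub_eq_zero_of_le h, add_zero]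
    · rw [min_eq_right h, add_tsub_cancel_of_le h]
  have hne : ∫⁻ t, min (t : ℝ≥0∞) (ρ i) ∂(a i).dist ≠ ⊤ := fun h => by
    rw [h, top_add] at h3
    exact ENNReal.coe_ne_top h3.symm
  lift (∫⁻ t, min (t : ℝ≥0∞) (ρ i) ∂(a i).dist) to ℝ≥0 using hne with k hk
  have h4 : k + (a i).cost = m := by exact_mod_cast h3
  rw [Project.surplus, h2, ← h4, NNReal.coe_add, add_sub_cancel_right]
  rfl

theorem min_le_cappedMax {ι : Type*} [Fintype ι] (ρ : ι → ℝ≥0∞) (y : ι → ℝ≥0) (i : ι) :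
    min (y i : ℝ≥0∞) (ρ i) ≤ cappedMax (fun y => y) ρ y :=
  le_max_of_le_right
    (Finset.le_sup (f := fun i => min (y i : ℝ≥0∞) (ρ i)) (Finset.mem_univ i))

theorem lintegral_capped_le {ι : Type*} [Fintype ι] (a : ι → Project) (ρ : ι → ℝ≥0∞) (i : ι) :
    ∫⁻ t, min (t : ℝ≥0∞) (ρ i) ∂(a i).dist ≤ ∫⁻ y, cappedMax (fun y => y) ρ y ∂law a := by
  rw [← lintegral_law_eval (a := a) i (f := fun t => min (t : ℝ≥0∞) (ρ i))
    (measurable_coe_nnreal_ennreal.min measurable_const)]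
  exact lintegral_mono fun y => min_le_cappedMax ρ y i

theorem surplus_le_totalSurplus_debt_zero {b : Project} (hb : b ∈ A) (h : 0 ≤ b.surplus) :
    ((b.surplus : ℝ) : EReal) ≤ totalSurplus (debt 0) A := by
  obtain ⟨I, ρ, hs, hI⟩ := exists_isIndexSystem_id A
  have hi := hI ⟨b, hb⟩ h
  refine le_trans (le_of_eq (lintegral_capped_eq hs hi).symm) ?_
  exact (EReal.coe_ennreal_le_coe_ennreal_iff.2 (lintegral_capped_le _ ρ _)).trans
    (le_totalSurplus_debt_zero hs)

end FirstBest

/-! ### Guarantee and efficiency of debt contracts -/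

section Debt

variable {A : Finset Project} {a₀ : Project} {z : ℝ≥0}

theorem debt_wage (y : ℝ≥0) : (debt z).wage y = y - z := rfl

/-- Under a debt contract that makes the known project worth sampling, some index policy of the
agent ends with a prize of at least `min y z`, where `y` is the prize of the known project. -/
theorem exists_isIndexSystem_debt (h0 : a₀ ∈ A)
    (hc : (a₀.cost : ℝ≥0∞) ≤ ∫⁻ t, ((t : ℝ≥0∞) - z) ∂a₀.dist) :
    ∃ (I : Finset A) (ρ : A → ℝ≥0∞), IsIndexSystem (family A) (debt z).wage I ρ ∧
      ∀ y, min (y ⟨a₀, h0⟩) z ≤ prize (debt z) (indexPolicy I ρ) y := by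
  classical
  obtain ⟨ρ, hρ⟩ := exists_isIndexSystem (family A) (debt z).measurable_wage fun i =>
    ne_top_of_le_ne_top (family A i).finite_mean.ne (lintegral_mono fun t =>
      ENNReal.coe_le_coe.2 (by rw [debt_wage]; exact tsub_le_self))
  refine ⟨_, ρ, hρ, fun y => ?_⟩
  set I := Finset.univ.filter fun i => ((family A i).cost : ℝ≥0∞) ≤
    ∫⁻ t, ((debt z).wage t : ℝ≥0∞) ∂(family A i).dist with hI
  have hmem : (⟨a₀, h0⟩ : A) ∈ I := by
    simpa [hI, family, debt_wage] using hc
  -- If the final prize is at most `z`, the final wage is `0`. No eligible project can then remain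
  -- unsampled, so `a₀` was sampled; all wages tie at `0`, and the largest prize is presented.
  rcases lt_or_ge z (prize (debt z) (indexPolicy I ρ) y) with h | h
  · exact (min_le_right _ _).trans h.le
  have hw : (debt z).wage (prize (debt z) (indexPolicy I ρ) y) = 0 := by
    rw [debt_wage, tsub_eq_zero_of_le h]
  refine (min_le_left _ _).trans (le_prize ?_ ?_)
  · by_contra hns
    have := index_lt_of_notMem_sampled hmem hns
    rw [hw] at this
    simp at this
  · refine le_antisymm (wage_le_bestWage ?_) ?_
    · by_contra hns
      have := index_lt_of_notMem_sampled hmem hns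
      rw [hw] at this
      simp at this
    · rw [← wage_prize, hw]
      exact zero_le

theorem le_principalValue_debt (h0 : a₀ ∈ A)
    (hc : (a₀.cost : ℝ≥0∞) ≤ ∫⁻ t, ((t : ℝ≥0∞) - z) ∂a₀.dist) :
    ((∫⁻ t, (min t z : ℝ≥0) ∂a₀.dist : ℝ≥0∞) : EReal) ≤ principalValue (debt z) A := by
  obtain ⟨I, ρ, hs, hp⟩ := exists_isIndexSystem_debt h0 hc
  refine le_iSup₂_of_le _ (indexPolicy_mem_optimalStrategies hs) ?_
  have hfin : expWage (family A) (debt z) (indexPolicy I ρ) ≠ ⊤ :=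
    ne_top_of_le_ne_top expPrize_ne_top (lintegral_mono fun y => ENNReal.coe_le_coe.2 (by
      rw [debt_wage]; exact tsub_le_self))
  rw [principalPayoff, EReal_le_sub_iff hfin]
  have h1 := lintegral_law_eval (a := family A) ⟨a₀, h0⟩
    (f := fun t => ((min t z : ℝ≥0) : ℝ≥0∞))
    (measurable_id.min measurable_const).coe_nnreal_ennreal
  change _ = ∫⁻ t, (min t z : ℝ≥0) ∂a₀.dist at h1
  have hm : Measurable fun y =>
      ((debt z).wage (prize (debt z) (indexPolicy I ρ) y) : ℝ≥0∞) :=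
    ((debt z).measurable_wage.comp measurable_prize).coe_nnreal_ennreal
  rw [← h1, expWage, expPrize, ← lintegral_add_right _ hm]
  refine lintegral_mono fun y => ?_
  rw [← ENNReal.coe_add, ENNReal.coe_le_coe, debt_wage]
  rcases le_total z (prize (debt z) (indexPolicy I ρ) y) with h | h
  · calc _ ≤ z + (prize (debt z) (indexPolicy I ρ) y - z) := add_le_add (min_le_right _ _) le_rfl
      _ = _ := add_tsub_cancel_of_le h
  · rw [tsub_eq_zero_of_le h, add_zero]
    exact hp y

theorem le_guarantee_debt (hc : (a₀.cost : ℝ≥0∞) ≤ ∫⁻ t, ((t : ℝ≥0∞) - z) ∂a₀.dist) :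
    ((∫⁻ t, (min t z : ℝ≥0) ∂a₀.dist : ℝ≥0∞) : EReal) ≤ guarantee a₀ (debt z) :=
  le_iInf₂ fun _ h0 => le_principalValue_debt h0 hc

/-- The agent's problem is the first-best problem with prizes lowered by `z`, so the caps shift to
`z + ρ i`. Truncation at `0` loses nothing because the final prize is almost surely at least `z`. -/
theorem isEfficient_debt (hz : ∀ᵐ t ∂a₀.dist, z ≤ t)
    (hc : (a₀.cost : ℝ≥0∞) ≤ ∫⁻ t, ((t : ℝ≥0∞) - z) ∂a₀.dist) : IsEfficient a₀ (debt z) := by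
  intro A h0 w'
  obtain ⟨I, ρ, hs, hp⟩ := exists_isIndexSystem_debt h0 hc
  refine (totalSurplus_le w' (ρ := fun i => z + ρ i) fun i => ?_).trans
    (le_iSup₂_of_le _ (indexPolicy_mem_optimalStrategies hs) ?_)
  · refine le_trans (le_of_eq ?_) (hs.le_cost i)
    simp only [debt_wage, ENNReal.coe_sub, tsub_add_eq_tsub_tsub]
  rw [jointPayoff, EReal_le_sub_iff expCost_ne_top]
  have h1 : ∫⁻ y, cappedMax (fun y => y) (fun i => z + ρ i) y ∂law (family A) ≤
      z + ∫⁻ y, cappedMax (debt z).wage ρ y ∂law (family A) := by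
    calc _ ≤ ∫⁻ y, (z + cappedMax (debt z).wage ρ y) ∂law (family A) := ?_
      _ = _ := by rw [lintegral_add_left measurable_const]; simp
    refine lintegral_mono fun y => max_le (by simp) (Finset.sup_le fun i _ => ?_)
    have h2 : min ((debt z).wage (y i) : ℝ≥0∞) (ρ i) ≤ cappedMax (debt z).wage ρ y :=
      le_max_of_le_right (Finset.le_sup (f := fun i => min ((debt z).wage (y i) : ℝ≥0∞) (ρ i))
        (Finset.mem_univ i))
    refine le_trans ?_ (add_le_add le_rfl h2)
    rw [debt_wage, ENNReal.coe_sub, ← min_add_add_left]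
    exact min_le_min_right _ le_add_tsub
  have h3 : z + expWage (family A) (debt z) (indexPolicy I ρ) ≤
      expPrize (family A) (debt z) (indexPolicy I ρ) := by
    calc _ = ∫⁻ y, ((z : ℝ≥0∞) + (debt z).wage (prize (debt z) (indexPolicy I ρ) y))
          ∂law (family A) := by rw [lintegral_add_left measurable_const]; simp [expWage]
      _ ≤ _ := lintegral_mono_ae ?_
    filter_upwards [ae_law_eval (a := family A) ⟨a₀, h0⟩ hz] with y hy
    rw [← ENNReal.coe_add, ENNReal.coe_le_coe, debt_wage]
    exact (add_tsub_cancel_of_le ((le_min hy le_rfl).trans (hp y))).le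
  calc _ ≤ z + ∫⁻ y, cappedMax (debt z).wage ρ y ∂law (family A) +
        expCost (family A) (debt z) (indexPolicy I ρ) := add_le_add h1 le_rfl
    _ ≤ z + expWage (family A) (debt z) (indexPolicy I ρ) := by
        rw [add_assoc]
        exact add_le_add le_rfl (le_expWage_indexPolicy hs)
    _ ≤ _ := h3

end Debt

/-! ### The known project alone: bounds on the agent's rent -/

section Known

variable {a₀ : Project} {w : Contract}

theorem sum_singleton_family {M : Type*} [AddCommMonoid M] (f : ({a₀} : Finset Project) → M) :
    ∑ i, f i = f ⟨a₀, Finset.mem_singleton_self a₀⟩ :=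
  Fintype.sum_eq_single _ fun i hi => absurd (Subtype.ext (Finset.mem_singleton.1 i.2)) hi

theorem coe_sub_coe (p x : ℝ≥0) :
    (((p : ℝ≥0∞) : EReal) - ((x : ℝ≥0∞) : EReal)) = ((p - x : ℝ) : EReal) := rfl

/-- With the known project only, the principal gets at most the surplus net of any rent that the
agent can secure. -/
theorem principalValue_singleton_le {b : ℝ≥0} (hs : 0 ≤ a₀.surplus)
    (hb : ∀ σ ∈ optimalStrategies (family {a₀}) w,
      b + expCost (family {a₀}) w σ ≤ expWage (family {a₀}) w σ) :
    principalValue w {a₀} ≤ ((a₀.surplus - b : ℝ) : EReal) := by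
  refine iSup₂_le fun σ hσ => ?_
  obtain ⟨m, hm, hm'⟩ := a₀.exists_mean_eq
  have h1 := lintegral_value_prize_le_const (a := family {a₀}) (w := w) (σ := σ)
    (h := fun y => y) measurable_id (C := 0) le_rfl
  have h2 := hb σ hσ
  rw [expCost_eq, sum_singleton_family] at h2
  rw [sum_singleton_family] at h1
  simp only [family, ENNReal.coe_zero, tsub_zero, zero_add, hm] at h1 h2
  have h3 := sampleProb_le_one (a := family {a₀}) (w := w) (σ := σ)
    ⟨a₀, Finset.mem_singleton_self a₀⟩
  change expPrize (family {a₀}) w σ ≤ _ at h1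
  change _ ≤ expWage (family {a₀}) w σ at h2
  rw [principalPayoff]
  set P := sampleProb (family {a₀}) w σ ⟨a₀, Finset.mem_singleton_self a₀⟩ with hP
  lift expPrize (family {a₀}) w σ to ℝ≥0 using expPrize_ne_top with p
  induction hx : expWage (family {a₀}) w σ with
  | top => simp
  | coe x =>
    rw [hx] at h2
    have h1' : p ≤ P * m := by exact_mod_cast h1
    have h2' : b + P * a₀.cost ≤ x := by exact_mod_cast h2
    rw [coe_sub_coe, EReal.coe_le_coe_iff]
    rw [Project.surplus, hm'] at hs ⊢
    rw [← NNReal.coe_le_coe] at h1' h2' h3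
    push_cast at h1' h2' h3
    -- `p - x ≤ P * (m - c₀) - b`, with `P ≤ 1` and nonnegative surplus.
    nlinarith

/-- Bounds on what the contract leaves to the agent if the principal gets at least `g` with the
known project only. -/
theorem rent_le (hs : 0 ≤ a₀.surplus) {g : ℝ} (hg : (g : EReal) ≤ principalValue w {a₀}) :
    (w.wage 0 : ℝ) ≤ a₀.surplus - g ∧
    ∫⁻ t, (max (w.wage 0) (w.wage t) : ℝ≥0) ∂a₀.dist ≤
      a₀.cost + ENNReal.ofReal (a₀.surplus - g) := by
  constructor
  · have := hg.trans (principalValue_singleton_le hs fun σ hσ => add_expCost_le_of_optimal hσ)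
    rw [EReal.coe_le_coe_iff] at this
    linarith
  · by_contra! hlt
    -- The slack `r` turns the strict excess into a rent `b` above `surplus - g`, leaving the
    -- principal less than `g`.
    obtain ⟨r, hr, hlt⟩ := ENNReal.lt_iff_exists_add_pos_lt.1 hlt
    have := hg.trans (principalValue_singleton_le (w := w)
      (b := Real.toNNReal (a₀.surplus - g) + r) hs fun σ hσ => ?_)
    · rw [EReal.coe_le_coe_iff] at this
      push_cast at this
      have h1 := Real.le_coe_toNNReal (a₀.surplus - g)
      have h2 : (0 : ℝ) < r := hr
      linarith
    · have h := lintegral_max_add_expCost_le_of_optimal hσ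
        ⟨a₀, Finset.mem_singleton_self a₀⟩
      have h' := (add_le_add hlt.le le_rfl).trans h
      have hc : (a₀.cost : ℝ≥0∞) ≠ ⊤ := ENNReal.coe_ne_top
      rw [← ENNReal.add_le_add_iff_right hc]
      refine le_trans (le_of_eq ?_) h'
      rw [ENNReal.coe_add]
      change ENNReal.ofReal (a₀.surplus - g) + r + _ + _ = _
      ring

end Known

/-! ### Test sets: the known project and a sure one -/

section Pair

open Classical

variable {a₀ : Project} {w : Contract}

theorem sum_pair_family {a₁ : Project} (hne : a₀ ≠ a₁) {M : Type*} [AddCommMonoid M]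
    (f : ({a₀, a₁} : Finset Project) → M) :
    ∑ i, f i = f ⟨a₀, by simp⟩ + f ⟨a₁, by simp⟩ := by
  refine Fintype.sum_eq_add _ _ (fun h => hne (congrArg Subtype.val h)) fun i hi => ?_
  rcases Finset.mem_insert.1 i.2 with h | h
  · exact absurd (Subtype.ext h) hi.1
  · exact absurd (Subtype.ext (Finset.mem_singleton.1 h)) hi.2

/-- A sure project that costs more than its wage is not sampled, so it adds no surplus. -/
theorem totalSurplus_pair_le_of_wage_lt (hs : 0 ≤ a₀.surplus)
    (hfin : ∫⁻ t, (w.wage t : ℝ≥0∞) ∂a₀.dist ≠ ⊤) {y₁ c₁ : ℝ≥0} (hne : a₀ ≠ Project.sure y₁ c₁)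
    (h : w.wage y₁ < c₁) :
    totalSurplus w {a₀, Project.sure y₁ c₁} ≤ ((a₀.surplus : ℝ) : EReal) := by
  set A : Finset Project := {a₀, Project.sure y₁ c₁} with hA
  refine iSup₂_le fun σ hσ => ?_
  obtain ⟨m, hm, hm'⟩ := a₀.exists_mean_eq
  have h1 := lintegral_value_prize_le_const (a := family A) (w := w) (σ := σ)
    (h := fun y => y) measurable_id (C := 0) le_rfl
  have h2 := lintegral_value_prize_le_const (a := family A) (w := w) (σ := σ)
    w.measurable_wage (C := w.wage 0) le_rfl
  have h3 := add_expCost_le_of_optimal hσ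
  have h4 := lintegral_max_add_expCost_le_of_optimal hσ ⟨a₀, by simp [A]⟩
  change expPrize (family A) w σ ≤ _ at h1
  change expWage (family A) w σ ≤ _ at h2
  have hcost : expCost (family A) w σ = _ := expCost_eq
  rw [sum_pair_family hne] at h1 h2 hcost
  set P := sampleProb (family A) w σ ⟨a₀, by simp [A]⟩ with hP
  set Q := sampleProb (family A) w σ ⟨Project.sure y₁ c₁, by simp [A]⟩ with hQ
  have hP1 : P ≤ 1 := sampleProb_le_one _
  have hemax : ∫⁻ t, (max (w.wage 0) (w.wage t) : ℝ≥0) ∂a₀.dist =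
      w.wage 0 + ∫⁻ t, ((w.wage t : ℝ≥0∞) - w.wage 0) ∂a₀.dist := by
    calc _ = ∫⁻ t, ((w.wage 0 : ℝ≥0∞) + ((w.wage t : ℝ≥0∞) - w.wage 0)) ∂a₀.dist := by
          refine lintegral_congr fun t => ?_
          rw [add_tsub_eq_max, ENNReal.coe_max]
      _ = _ := by rw [lintegral_add_left measurable_const]; simp
  have hefin : ∫⁻ t, ((w.wage t : ℝ≥0∞) - w.wage 0) ∂a₀.dist ≠ ⊤ :=
    ne_top_of_le_ne_top hfin (lintegral_mono fun t => tsub_le_self)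
  simp only [family, Project.sure_dist, Project.sure_cost, lintegral_dirac, ENNReal.coe_zero,
    tsub_zero, zero_add, hm] at h1 h2 hcost h4
  rw [hemax] at h4
  lift (∫⁻ t, ((w.wage t : ℝ≥0∞) - w.wage 0) ∂a₀.dist) to ℝ≥0 using hefin with e
  rw [← ENNReal.coe_sub] at h2
  rw [jointPayoff, hcost]
  change _ ≤ expWage (family A) w σ at h3
  change _ ≤ expWage (family A) w σ + _ at h4
  change _ + expCost (family A) w σ ≤ _ at h3
  change _ + expCost (family A) w σ ≤ _ at h4
  rw [hcost] at h3 h4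
  have hWfin : expWage (family A) w σ ≠ ⊤ := ne_top_of_le_ne_top (by finiteness) h2
  lift expWage (family A) w σ to ℝ≥0 using hWfin with W
  lift expPrize (family A) w σ to ℝ≥0 using expPrize_ne_top with p
  have h1' : p ≤ P * m + Q * y₁ := by exact_mod_cast h1
  have h2' : W ≤ w.wage 0 + (P * e + Q * (w.wage y₁ - w.wage 0)) := by exact_mod_cast h2
  have h3' : w.wage 0 + (P * a₀.cost + Q * c₁) ≤ W := by exact_mod_cast h3
  have h4' : w.wage 0 + e + (P * a₀.cost + Q * c₁) ≤ W + a₀.cost := by exact_mod_cast h4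
  have hd : w.wage y₁ - w.wage 0 < c₁ := tsub_le_self.trans_lt h
  set d := w.wage y₁ - w.wage 0
  rw [coe_sub_coe, EReal.coe_le_coe_iff]
  rw [Project.surplus, hm'] at hs ⊢
  have hQ0 : (0 : ℝ) ≤ Q := Q.2
  have hP0 : (0 : ℝ) ≤ P := P.2
  rw [← NNReal.coe_le_coe] at h1' h2' h3' h4' hP1
  rw [← NNReal.coe_lt_coe] at hd
  push_cast at h1' h2' h3' h4' hP1 ⊢
  -- The agent earns at most `w 0 + P * (e - c₀) - Q * (c₁ - d)`. If `Q > 0`, stopping at once (when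
  -- `e ≤ c₀`) or sampling only `a₀` (when `c₀ ≤ e`) is strictly better.
  have hQz : (Q : ℝ) = 0 := by
    by_contra hQne
    have hQpos : (0 : ℝ) < Q := lt_of_le_of_ne hQ0 (Ne.symm hQne)
    have h5 : (0 : ℝ) < Q * (c₁ - d) := mul_pos hQpos (sub_pos.2 hd)
    rcases le_total (e : ℝ) a₀.cost with h6 | h6
    · nlinarith [mul_nonneg hP0 (sub_nonneg.2 h6)]
    · nlinarith [mul_nonneg (sub_nonneg.2 hP1) (sub_nonneg.2 h6)]
  rw [hQz] at h1' ⊢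
  nlinarith [mul_nonneg (sub_nonneg.2 hP1) hs]

/-- A sure project whose wage exceeds its cost, but which costs more than the prize in excess of
the known surplus, is sampled and destroys surplus if the known project leaves no rent. -/
theorem totalSurplus_pair_le_of_lt_wage {s : ℝ≥0} (hs : (s : ℝ) = a₀.surplus)
    (hle : ∫⁻ t, ((t : ℝ≥0∞) - s) ∂a₀.dist ≤ a₀.cost) (hw0 : w.wage 0 = 0)
    (hw : ∫⁻ t, (w.wage t : ℝ≥0∞) ∂a₀.dist ≤ a₀.cost) {y₁ c₁ : ℝ≥0}
    (hne : a₀ ≠ Project.sure y₁ c₁) (h : c₁ < w.wage y₁) :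
    totalSurplus w {a₀, Project.sure y₁ c₁} ≤
      ((a₀.surplus - (c₁ - (y₁ - s : ℝ≥0)) : ℝ) : EReal) := by
  set A : Finset Project := {a₀, Project.sure y₁ c₁} with hA
  refine iSup₂_le fun σ hσ => ?_
  have h1 := lintegral_value_prize_le_const (a := family A) (w := w) (σ := σ)
    (h := fun y => y) measurable_id (C := s) zero_le
  have h2 := lintegral_value_prize_le_const (a := family A) (w := w) (σ := σ)
    w.measurable_wage (C := 0) hw0.le
  have h4 := lintegral_max_add_expCost_le_of_optimal hσ ⟨Project.sure y₁ c₁, by simp [A]⟩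
  change expPrize (family A) w σ ≤ _ at h1
  change expWage (family A) w σ ≤ _ at h2
  have hcost : expCost (family A) w σ = _ := expCost_eq
  rw [sum_pair_family hne] at h1 h2 hcost
  set P := sampleProb (family A) w σ ⟨a₀, by simp [A]⟩ with hP
  set Q := sampleProb (family A) w σ ⟨Project.sure y₁ c₁, by simp [A]⟩ with hQ
  have hQ1 : Q ≤ 1 := sampleProb_le_one _
  simp only [family, Project.sure_dist, Project.sure_cost, lintegral_dirac, ENNReal.coe_zero,
    tsub_zero, zero_add, hw0, zero_le, max_eq_right] at h1 h2 hcost h4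
  change _ + expCost (family A) w σ ≤ expWage (family A) w σ + _ at h4
  rw [jointPayoff, hcost]
  rw [hcost] at h4
  have h1a := h1.trans (add_le_add le_rfl (add_le_add (mul_le_mul_right hle _) le_rfl))
  have h2a := h2.trans (add_le_add (mul_le_mul_right hw _) le_rfl)
  rw [← ENNReal.coe_sub] at h1a
  have hWfin : expWage (family A) w σ ≠ ⊤ := ne_top_of_le_ne_top (by finiteness) h2a
  lift expWage (family A) w σ to ℝ≥0 using hWfin with W
  lift expPrize (family A) w σ to ℝ≥0 using expPrize_ne_top with p
  have h1' : p ≤ s + (P * a₀.cost + Q * (y₁ - s)) := by exact_mod_cast h1a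
  have h2' : W ≤ P * a₀.cost + Q * w.wage y₁ := by exact_mod_cast h2a
  have h4' : w.wage y₁ + (P * a₀.cost + Q * c₁) ≤ W + c₁ := by exact_mod_cast h4
  rw [coe_sub_coe, EReal.coe_le_coe_iff, ← hs]
  set d := y₁ - s
  rw [← NNReal.coe_le_coe] at h1' h2' h4' hQ1
  rw [← NNReal.coe_lt_coe] at h
  push_cast at h1' h2' h4' hQ1 ⊢
  -- As `a₀` leaves no rent, the agent earns at most `Q * (w y₁ - c₁)`, while the sure project alone
  -- yields `w y₁ - c₁`.
  have hQz : (Q : ℝ) = 1 := by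
    by_contra hQne
    have hQlt : (Q : ℝ) < 1 := lt_of_le_of_ne hQ1 hQne
    nlinarith [mul_pos (sub_pos.2 hQlt) (sub_pos.2 h)]
  rw [hQz] at h1' ⊢
  linarith

/-- The test project has sure prize `y` and cost `y - q`, hence surplus `q`. The agent refuses it
because `w y < y - q`, so efficiency requires that it add nothing to the known surplus, not even
option value. The condition `q ≠ s` keeps it distinct from `a₀`. -/
theorem le_of_isEfficient (hw : IsEfficient a₀ w)
    (hfin : ∫⁻ t, (w.wage t : ℝ≥0∞) ∂a₀.dist ≠ ⊤) {s : ℝ≥0} (hs : (s : ℝ) = a₀.surplus)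
    {y q : ℝ≥0} (hlt : w.wage y + q < y) (hq : q ≠ s) :
    q ≤ s ∧ ∀ᵐ t ∂a₀.dist, q ≤ t := by
  have hqy : q ≤ y := le_add_self.trans hlt.le
  have hs0 : 0 ≤ a₀.surplus := hs ▸ s.2
  have hs1 : (Project.sure y (y - q)).surplus = q := by
    rw [Project.surplus_sure, NNReal.coe_sub hqy]
    ring
  have hne : a₀ ≠ Project.sure y (y - q) := by
    intro h
    apply hq
    rw [← NNReal.coe_inj, hs, ← hs1, ← h]
  have h0 : a₀ ∈ ({a₀, Project.sure y (y - q)} : Finset Project) := by simp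
  have h1 : Project.sure y (y - q) ∈ ({a₀, Project.sure y (y - q)} : Finset Project) := by simp
  have hle := (hw _ h0 (debt 0)).trans (totalSurplus_pair_le_of_wage_lt hs0 hfin hne
    (lt_tsub_iff_right.2 hlt))
  constructor
  · have := (surplus_le_totalSurplus_debt_zero h1 (by rw [hs1]; exact q.2)).trans hle
    rw [EReal.coe_le_coe_iff, hs1, ← hs] at this
    exact this
  · obtain ⟨I, ρ, hI, hmem⟩ :=
      exists_isIndexSystem_id ({a₀, Project.sure y (y - q)} : Finset Project)
    have hi0 := hmem ⟨a₀, h0⟩ hs0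
    have hi1 := hmem ⟨_, h1⟩ (by change 0 ≤ (Project.sure y (y - q)).surplus; rw [hs1]; exact q.2)
    have hE := (le_totalSurplus_debt_zero hI).trans hle
    have hκ := lintegral_capped_eq hI hi0
    change _ = ((a₀.surplus : ℝ) : EReal) at hκ
    rw [← hκ, EReal.coe_ennreal_le_coe_ennreal_iff,
      ← lintegral_law_eval (a := family _) ⟨a₀, h0⟩
        (f := fun t => min (t : ℝ≥0∞) (ρ ⟨a₀, h0⟩))
        (measurable_coe_nnreal_ennreal.min measurable_const)] at hE
    have hfinE : ∫⁻ y, min (y ⟨a₀, h0⟩ : ℝ≥0∞) (ρ ⟨a₀, h0⟩)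
        ∂law (family {a₀, Project.sure y (y - q)}) ≠ ⊤ := by
      rw [lintegral_law_eval (a := family _) ⟨a₀, h0⟩
        (f := fun t => min (t : ℝ≥0∞) (ρ ⟨a₀, h0⟩))
        (measurable_coe_nnreal_ennreal.min measurable_const)]
      exact ne_top_of_le_ne_top a₀.finite_mean.ne (lintegral_mono fun t => min_le_left _ _)
    -- The first best dominates the capped prize of `a₀` pointwise but not in expectation, so they
    -- agree almost surely.
    have hae := ae_eq_of_ae_le_of_lintegral_le
      (Filter.Eventually.of_forall fun y => min_le_cappedMax ρ y ⟨a₀, h0⟩) hfinE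
      (measurable_cappedMax measurable_id ρ).aemeasurable hE
    have hy1 := ae_law_eval (a := family {a₀, Project.sure y (y - q)}) ⟨_, h1⟩
      (p := fun t => t = y) (by simp [family])
    -- The fair cap of the sure project is `q`, or anything from `y` upwards when `q = y` and it is
    -- free.
    have hcap : (q : ℝ≥0∞) ≤ min (y : ℝ≥0∞) (ρ ⟨_, h1⟩) := by
      have h := hI.eq_cost _ hi1
      simp only [family, Project.sure_dist, Project.sure_cost, lintegral_dirac] at h
      refine le_min (ENNReal.coe_le_coe.2 hqy) ?_
      by_contra! hlt'
      lift ρ ⟨_, h1⟩ to ℝ≥0 using hlt'.ne_top with r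
      rw [ENNReal.coe_lt_coe] at hlt'
      rw [← ENNReal.coe_sub, ENNReal.coe_inj] at h
      exact (tsub_lt_tsub_left_of_le hqy hlt').ne' h
    have hall : ∀ᵐ x ∂law (family {a₀, Project.sure y (y - q)}), q ≤ x ⟨a₀, h0⟩ := by
      filter_upwards [hae, hy1] with x hx hx1
      have h2 := min_le_cappedMax ρ x ⟨_, h1⟩
      rw [← hx, hx1] at h2
      exact_mod_cast (hcap.trans h2).trans (min_le_left _ _)
    have hmp := measurePreserving_eval
      (fun i => (family {a₀, Project.sure y (y - q)} i).dist) ⟨a₀, h0⟩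
    have := ae_map_iff (μ := law (family {a₀, Project.sure y (y - q)}))
      hmp.measurable.aemeasurable (p := fun t : ℝ≥0 => q ≤ t) measurableSet_Ici
    have hmap := hmp.map_eq
    change Measure.map _ (law (family {a₀, Project.sure y (y - q)})) = a₀.dist at hmap
    rw [hmap] at this
    exact this.2 hall

end Pair

/-! ### The two cases of the theorem -/

section Main

variable {a₀ : Project} {w : Contract} {s : ℝ≥0}

theorem surplus_add_cost (hs : (s : ℝ) = a₀.surplus) :
    ∫⁻ t, (t : ℝ≥0∞) ∂a₀.dist = s + a₀.cost := by
  obtain ⟨m, hm, hm'⟩ := a₀.exists_mean_eq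
  rw [Project.surplus, hm'] at hs
  have : m = s + a₀.cost := by
    rw [← NNReal.coe_inj]
    push_cast
    linarith
  rw [hm, this, ENNReal.coe_add]

/-- Since `t ≤ s + (t - s)⁺`, debt with face value equal to the surplus always leaves the known
project worth sampling, in both cases of the theorem. -/
theorem cost_le_lintegral_sub (hs : (s : ℝ) = a₀.surplus) :
    (a₀.cost : ℝ≥0∞) ≤ ∫⁻ t, ((t : ℝ≥0∞) - s) ∂a₀.dist := by
  have h : ∫⁻ t, (t : ℝ≥0∞) ∂a₀.dist ≤ s + ∫⁻ t, ((t : ℝ≥0∞) - s) ∂a₀.dist := by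
    calc _ ≤ ∫⁻ t, ((s : ℝ≥0∞) + ((t : ℝ≥0∞) - s)) ∂a₀.dist :=
          lintegral_mono fun t => le_add_tsub
      _ = _ := by rw [lintegral_add_left measurable_const]; simp
  rw [surplus_add_cost hs] at h
  exact (ENNReal.add_le_add_iff_left ENNReal.coe_ne_top).1 h

theorem lintegral_sub_eq_cost (hs : (s : ℝ) = a₀.surplus) (hae : ∀ᵐ t ∂a₀.dist, s ≤ t) :
    ∫⁻ t, ((t : ℝ≥0∞) - s) ∂a₀.dist = a₀.cost := by
  have h : s + ∫⁻ t, ((t : ℝ≥0∞) - s) ∂a₀.dist = ∫⁻ t, (t : ℝ≥0∞) ∂a₀.dist := by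
    calc _ = ∫⁻ t, ((s : ℝ≥0∞) + ((t : ℝ≥0∞) - s)) ∂a₀.dist := by
          rw [lintegral_add_left measurable_const]; simp
      _ = _ := lintegral_congr_ae (by
          filter_upwards [hae] with t ht
          exact add_tsub_cancel_of_le (ENNReal.coe_le_coe.2 ht))
  rw [surplus_add_cost hs] at h
  exact (ENNReal.add_right_inj ENNReal.coe_ne_top).1 h

/-- Dropping the positive part gives `mean - r ≤ cost` for every solution `r`, that is `s ≤ r`; at
`r = s` the positive part is inactive. -/
theorem isLeast_indexSolutions (hs : (s : ℝ) = a₀.surplus) (hae : ∀ᵐ t ∂a₀.dist, s ≤ t) :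
    IsLeast a₀.indexSolutions s := by
  constructor
  · have h : ∫ t : ℝ≥0, max ((t : ℝ) - s) 0 ∂a₀.dist = ∫ t : ℝ≥0, ((t : ℝ) - s) ∂a₀.dist :=
      integral_congr_ae (by
        filter_upwards [hae] with t ht
        exact max_eq_left (sub_nonneg.2 (NNReal.coe_le_coe.2 ht)))
    change (a₀.cost : ℝ) = _
    rw [h, integral_sub a₀.integrable_coe (integrable_const _), hs]
    simp [Project.surplus, Project.mean]
  · intro r hr
    have hi : Integrable (fun t : ℝ≥0 => (t : ℝ) - r) a₀.dist :=
      a₀.integrable_coe.sub (integrable_const _)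
    have h : ∫ t : ℝ≥0, ((t : ℝ) - r) ∂a₀.dist ≤ ∫ t : ℝ≥0, max ((t : ℝ) - r) 0 ∂a₀.dist :=
      integral_mono hi hi.pos_part fun t => le_max_left _ _
    rw [integral_sub a₀.integrable_coe (integrable_const _)] at h
    have hr' : (a₀.cost : ℝ) = _ := hr
    rw [← hr'] at h
    simp only [integral_const, probReal_univ, one_smul] at h
    rw [hs, Project.surplus, Project.mean]
    linarith

theorem guarantee_le_principalValue (w : Contract) :
    guarantee a₀ w ≤ principalValue w {a₀} :=
  iInf₂_le (f := fun A (_ : a₀ ∈ A) => principalValue w A) {a₀} (Finset.mem_singleton_self a₀)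

theorem guarantee_le_surplus (hs : 0 ≤ a₀.surplus) (w : Contract) :
    guarantee a₀ w ≤ ((a₀.surplus : ℝ) : EReal) := by
  refine (guarantee_le_principalValue w).trans ?_
  have h := principalValue_singleton_le (w := w) (b := 0) hs fun σ hσ =>
    (add_le_add (zero_le : ((0 : ℝ≥0) : ℝ≥0∞) ≤ w.wage 0) le_rfl).trans
      (add_expCost_le_of_optimal hσ)
  simpa using h

theorem surplus_le_guarantee_debt (hs : (s : ℝ) = a₀.surplus) (hae : ∀ᵐ t ∂a₀.dist, s ≤ t) :
    ((a₀.surplus : ℝ) : EReal) ≤ guarantee a₀ (debt s) := by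
  refine le_trans (le_of_eq ?_) (le_guarantee_debt (cost_le_lintegral_sub hs))
  have h : ∫⁻ t, (min t s : ℝ≥0) ∂a₀.dist = s := by
    calc _ = ∫⁻ _, (s : ℝ≥0∞) ∂a₀.dist := lintegral_congr_ae (by
          filter_upwards [hae] with t ht
          rw [min_eq_right ht])
      _ = _ := by simp
  rw [h, ← hs]
  rfl

theorem IsRobustlyOptimal.guarantee_le (hw : IsRobustlyOptimal a₀ w) (w' : Contract) :
    guarantee a₀ w' ≤ guarantee a₀ w := by
  rw [hw]
  exact le_iSup (fun w' => guarantee a₀ w') w'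

theorem robustlyOptimal_and_efficient_iff (hs : (s : ℝ) = a₀.surplus)
    (hae : ∀ᵐ t ∂a₀.dist, s ≤ t) (w : Contract) :
    IsRobustlyOptimal a₀ w ∧ IsEfficient a₀ w ↔ w = debt s := by
  classical
  have hs0 : 0 ≤ a₀.surplus := hs ▸ s.2
  constructor
  · rintro ⟨hr, he⟩
    have hg := ((surplus_le_guarantee_debt hs hae).trans (hr.guarantee_le _)).trans
      (guarantee_le_principalValue w)
    obtain ⟨h1, h2⟩ := rent_le hs0 hg
    rw [sub_self] at h1 h2
    have hw0 : w.wage 0 = 0 := by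
      rw [← NNReal.coe_inj]
      exact le_antisymm h1 (w.wage 0).2
    simp only [hw0, zero_le, max_eq_right, ENNReal.ofReal_zero, add_zero] at h2
    have hfin := ne_top_of_le_ne_top ENNReal.coe_ne_top h2
    ext y
    refine congrArg NNReal.toReal (le_antisymm ?_ ?_)
    · rw [debt_wage]
      by_contra! hlt
      -- At a cost `c` with `y - s < c < w y` the agent samples the sure prize `y`, although its
      -- surplus is below `s`.
      obtain ⟨c, hc1, hc2⟩ := exists_between hlt
      have hcr : (y : ℝ) - s < c := by
        have := NNReal.coe_lt_coe.2 hc1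
        exact (le_max_left _ _).trans_lt (NNReal.coe_sub_def ▸ this)
      have hne : a₀ ≠ Project.sure y c := by
        intro h
        have h3 := Project.surplus_sure y c
        rw [← h, ← hs] at h3
        linarith
      have h3 := totalSurplus_pair_le_of_lt_wage hs (lintegral_sub_eq_cost hs hae).le hw0 h2 hne hc2
      have h4 := (surplus_le_totalSurplus_debt_zero (A := {a₀, Project.sure y c}) (b := a₀)
        (by simp) hs0).trans ((he _ (by simp) (debt 0)).trans h3)
      rw [EReal.coe_le_coe_iff] at h4
      have h5 := NNReal.coe_lt_coe.2 hc1
      linarith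
    · rw [debt_wage]
      by_contra! hlt
      rw [lt_tsub_iff_right, add_comm] at hlt
      -- Now `s < q < y - w y`: the agent refuses a sure project of surplus `q > s`.
      obtain ⟨q, hq1, hq2⟩ := exists_between (lt_tsub_iff_right.2 hlt)
      have := (le_of_isEfficient he hfin hs
        (by rw [add_comm]; exact lt_tsub_iff_right.1 hq2) hq1.ne').1
      exact absurd this (not_le.2 hq1)
  · rintro rfl
    refine ⟨le_antisymm (le_iSup (fun w' => guarantee a₀ w') _) ?_,
      isEfficient_debt hae (cost_le_lintegral_sub hs)⟩
    exact iSup_le fun w' => (guarantee_le_surplus hs0 w').trans (surplus_le_guarantee_debt hs hae)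

/-- If the wage leaves at most `l` of each prize to the principal, then she gets at most `l`. -/
theorem principalValue_le_of_le_add {l : ℝ≥0} (hw : ∀ y, y ≤ l + w.wage y) (A : Finset Project) :
    principalValue w A ≤ ((l : ℝ≥0∞) : EReal) := by
  refine iSup₂_le fun σ _ => ?_
  rw [principalPayoff]
  by_cases hx : expWage (family A) w σ = ⊤
  · rw [hx, EReal.coe_ennreal_top, EReal.sub_top]
    exact bot_le
  · rw [EReal_sub_le_iff hx]
    calc expPrize (family A) w σ
        ≤ ∫⁻ y, ((l : ℝ≥0∞) + w.wage (prize w σ y)) ∂law (family A) :=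
          lintegral_mono fun y => by
            rw [← ENNReal.coe_add]
            exact ENNReal.coe_le_coe.2 (hw _)
      _ = _ := by rw [lintegral_add_left measurable_const]; simp [expWage]

/-- `E[min y₀ s] = l` would force `y₀ = l` almost surely, so that `s ≤ s + c₀ = l`. -/
theorem lowest_lt_guarantee_debt {l : ℝ≥0} (hl : (l : ℝ) = a₀.lowest) (hs : (s : ℝ) = a₀.surplus)
    (hlt : l < s) : ((l : ℝ≥0∞) : EReal) < guarantee a₀ (debt s) := by
  refine lt_of_lt_of_le ?_ (le_guarantee_debt (cost_le_lintegral_sub hs))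
  rw [EReal.coe_ennreal_lt_coe_ennreal_iff]
  by_contra! hle
  have hae : ∀ᵐ t ∂a₀.dist, l ≤ t := by
    filter_upwards [a₀.ae_lowest_le] with t ht
    rwa [← hl, NNReal.coe_le_coe] at ht
  have hle1 : (fun _ => (l : ℝ≥0∞)) ≤ᵐ[a₀.dist] fun t => ((min t s : ℝ≥0) : ℝ≥0∞) := by
    filter_upwards [hae] with t ht
    exact ENNReal.coe_le_coe.2 (le_min ht hlt.le)
  have heq := ae_eq_of_ae_le_of_lintegral_le hle1 (by simp)
    (measurable_id.min measurable_const).coe_nnreal_ennreal.aemeasurable (by simpa using hle)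
  have hm : ∫⁻ t, (t : ℝ≥0∞) ∂a₀.dist = l := by
    calc _ = ∫⁻ _, (l : ℝ≥0∞) ∂a₀.dist := lintegral_congr_ae (by
          filter_upwards [heq] with t ht
          have h1 : l = min t s := ENNReal.coe_inj.1 ht
          rcases min_choice t s with h2 | h2
          · rw [h1, h2]
          · exact absurd (h1.trans h2) hlt.ne)
      _ = _ := by simp
  rw [surplus_add_cost hs] at hm
  have h1 : s + a₀.cost = l := by exact_mod_cast hm
  exact absurd (h1 ▸ le_self_add : s ≤ l) (not_le.2 hlt)

theorem not_isEfficient_of_isRobustlyOptimal {l : ℝ≥0} (hl : (l : ℝ) = a₀.lowest)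
    (hs : (s : ℝ) = a₀.surplus) (hlt : l < s) (hr : IsRobustlyOptimal a₀ w) :
    ¬ IsEfficient a₀ w := by
  intro he
  have hg := ((lowest_lt_guarantee_debt hl hs hlt).trans_le (hr.guarantee_le _)).trans_le
    (guarantee_le_principalValue w)
  have hfin : ∫⁻ t, (w.wage t : ℝ≥0∞) ∂a₀.dist ≠ ⊤ := by
    have h := (rent_le (hs ▸ s.2) (g := (l : ℝ)) hg.le).2
    refine ne_top_of_le_ne_top (b := (a₀.cost : ℝ≥0∞) + ENNReal.ofReal (a₀.surplus - l))
      (by finiteness) (le_trans (lintegral_mono fun t => ?_) h)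
    exact ENNReal.coe_le_coe.2 (le_max_right _ _)
  refine absurd hg (not_lt.2 (principalValue_le_of_le_add (fun y => ?_) _))
  by_contra! hy
  -- `q < y - w y` makes the agent refuse the test project, `q < s` separates it from `a₀`, and `q >
  -- l` contradicts `q ≤ y₀` almost surely.
  obtain ⟨q, hq1, hq2⟩ := exists_between (lt_min (lt_tsub_iff_right.2 hy) hlt)
  have h := (le_of_isEfficient he hfin hs (y := y) (q := q)
    (by rw [add_comm]; exact lt_tsub_iff_right.1 (hq2.trans_le (min_le_left _ _)))
    (hq2.trans_le (min_le_right _ _)).ne).2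
  exact Project.not_ae_le (by rw [← hl]; exact NNReal.coe_lt_coe.2 hq1) h

end Main

end RobustSearch

open RobustSearch in
theorem proposition6 (a₀ : Project) (hs : 0 ≤ a₀.surplus) :
    (a₀.mean - a₀.lowest ≤ (a₀.cost : ℝ) →
      IsLeast a₀.indexSolutions a₀.index ∧
      ∀ w : Contract, (IsRobustlyOptimal a₀ w ∧ IsEfficient a₀ w) ↔ w = debt a₀.index) ∧
    ((a₀.cost : ℝ) < a₀.mean - a₀.lowest →
      ∀ w : Contract, IsRobustlyOptimal a₀ w → ¬ IsEfficient a₀ w) := by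
  obtain ⟨s, hs'⟩ : ∃ s : ℝ≥0, (s : ℝ) = a₀.surplus := ⟨⟨_, hs⟩, rfl⟩
  constructor
  · intro h
    -- The cost condition rearranges to `s ≤ a₀.lowest`.
    have hae : ∀ᵐ t ∂a₀.dist, s ≤ t := by
      filter_upwards [a₀.ae_lowest_le] with t ht
      rw [← NNReal.coe_le_coe, hs', Project.surplus]
      linarith
    have hleast := isLeast_indexSolutions hs' hae
    have hidx : a₀.index = s := hleast.csInf_eq
    rw [hidx]
    exact ⟨hleast, robustlyOptimal_and_efficient_iff hs' hae⟩
  · intro h w hr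
    refine not_isEfficient_of_isRobustlyOptimal (l := sInf a₀.dist.support) rfl hs' ?_ hr
    rw [← NNReal.coe_lt_coe, hs', Project.surplus]
    change a₀.lowest < _
    linarith
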